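/- **Theorem (weighted Strichartz estimates).** Fix a smooth function $\psi:\mathbb R\to[0,1]$ with $\psi=1$ on $[-\frac54,\frac54]$ and $\psi=0$ outside $[-\frac85,\frac85]$. For $\xi\in\mathbb R^3$ put $\psi_{-1}(\xi)=\psi(2|\xi|)$ and $\psi_k(\xi)=\psi(|\xi|/2^k)-\psi(|\xi|/2^{k-1})$ for integers $k\ge 0$. With $\hat f(\xi)=\int_{\mathbb R^3}e^{-ix\cdot\xi}f(x)\,dx$, let $P_k$ be the Fourier multiplier with symbol $\psi_k(\xi)$ on tempered distributions, and let $|\nabla|^{-\iota}e^{\pm is|\nabla|}$, $\iota\in\{0,1\}$, be the Fourier multiplier with symbol $|\xi|^{-\iota}e^{\pm is|\xi|}$. Write $\langle x\rangle=(1+|x|^2)^{1/2}$. Let $\beta_1\in(0,1)$ and $\beta_2\in(\beta_1,\min\{\frac32\beta_1,1\})$. 1. Let $p\in[2,\infty)$ and $r\in(2,\infty]$ with $\frac1p+\frac1r=\frac12$. There is a constant $C>0$, depending only on $\psi,\beta_1,\beta_2,p$, such that for both signs $\pm$, all integers $k\ge-1$, all $t\ge t_0\ge0$ and all complex-valued tempered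 distributions $f$ on $\mathbb R^3$ with $P_kf\in L^2(\mathbb R^3)$, $$\big\|(1+s+|x|)^{\frac{\beta_1}{p}}P_ke^{\pm is|\nabla|}f\big\|_{L^p_s([t_0,t];L^r_x(\mathbb R^3))}\le C\,2^{\frac2p(1+\beta_2)k}\big\|\langle x\rangle^{\frac2p\beta_2}P_kf\big\|_{L^2(\mathbb R^3)}.$$ 2. Let $p\in[2,2+2\beta_2-\beta_1)$ and $r\in(2+\frac{4}{2\beta_2-\beta_1},\infty]$ with $\frac1p+\frac1r=\frac12$. There is a constant $C>0$, depending only on $\psi,\beta_1,\beta_2,p$, such that for the same $\pm,k,t_0,t,f$, $$\big\|(1+s+|x|)^{\frac{\beta_1}{p}}P_k|\nabla|^{-1}e^{\pm is|\nabla|}f\big\|_{L^p_s([t_0,t];L^r_x(\mathbb R^3))}\le C\,2^{(\frac{2+2\beta_2}{p}-1)k}\big\|\langle x\rangle^{\frac2p\beta_2}P_kf\big\|_{L^2(\mathbb R^3)}.$$ Here, for $\iota\in\{0,1\}$ and every $s\in\mathbb R$, the function $|\xi|^{-\iota}e^{\pm is|\xi|}\widehat{P_kf}(\xi)$ is integrable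 over $\mathbb R^3$, and $P_k|\nabla|^{-\iota}e^{\pm is|\nabla|}f$ is its inverse Fourier transform. The right-hand sides may be infinite. -/

import Mathlib

open MeasureTheory FourierTransform SchwartzMap
open scoped ENNReal ContDiff

noncomputable section

/-- Three-dimensional Euclidean space. -/
abbrev E3 : Type := EuclideanSpace ℝ (Fin 3)

/-- A smooth cutoff `ψ : ℝ → [0, 1]`, equal to `1` on `[-5/4, 5/4]` and vanishing outside
`[-8/5, 8/5]`. -/
structure IsCutoff (ψ : ℝ → ℝ) : Prop where
  smooth : ContDiff ℝ ∞ ψ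
  mem_Icc : ∀ y, ψ y ∈ Set.Icc (0 : ℝ) 1
  eq_one : ∀ y ∈ Set.Icc (-(5 / 4) : ℝ) (5 / 4), ψ y = 1
  eq_zero : ∀ y ∉ Set.Icc (-(8 / 5) : ℝ) (8 / 5), ψ y = 0

/-- The nonhomogeneous dyadic partition of unity `ψ_k`, `k ≥ -1`, on `ℝ³`:
`ψ_{-1}(ξ) = ψ(2|ξ|)` and `ψ_k(ξ) = ψ(|ξ|/2^k) - ψ(|ξ|/2^{k-1})` for `k ≥ 0`. -/
def dyadic (ψ : ℝ → ℝ) (k : ℤ) (ξ : E3) : ℝ :=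
  if k = -1 then ψ (2 * ‖ξ‖) else ψ (‖ξ‖ / 2 ^ k) - ψ (‖ξ‖ / 2 ^ (k - 1))

/-- The Littlewood-Paley projection `P_k` on tempered distributions, i.e. the Fourier multiplier
`ψ_k(ξ)`. Here and below symbols are functions of the frequency `ξ` of the convention
`∫ e^{-i x·ξ} f(x) dx`; Mathlib's Fourier transform `∫ e^{-2πi x·η} f(x) dx` has `ξ = 2πη`. -/
def lpProj (ψ : ℝ → ℝ) (k : ℤ) : 𝓢'(E3, ℂ) →L[ℂ] 𝓢'(E3, ℂ) :=
  TemperedDistribution.fourierMultiplierCLM ℂ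
    (fun η : E3 => (dyadic ψ k ((2 * Real.pi) • η) : ℂ))

/-- The symbol `|ξ|^{-ι} e^{i σ s |ξ|}` of `|∇|^{-ι} e^{i σ s |∇|}`. -/
def waveSymbol (ι : ℕ) (σ s : ℝ) (ξ : E3) : ℂ :=
  ((‖ξ‖⁻¹ ^ ι : ℝ) : ℂ) * Complex.exp (Complex.I * ((σ * s * ‖ξ‖ : ℝ) : ℂ))

/-- The Fourier transform of `|∇|^{-ι} e^{i σ s |∇|} g`, for `g ∈ L²(ℝ³)`. -/
def waveFreq (ι : ℕ) (σ s : ℝ) (g : Lp ℂ 2 (volume : Measure E3)) (η : E3) : ℂ :=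
  waveSymbol ι σ s ((2 * Real.pi) • η) * (𝓕 g : Lp ℂ 2 (volume : Measure E3)) η

/-- The function `x ↦ |∇|^{-ι} e^{i σ s |∇|} g (x)`, given by the Fourier inversion integral.
It is used for `g = P_k f ∈ L²(ℝ³)`, whose Fourier transform is square integrable with bounded
support, so that the integrand `waveFreq` is integrable. -/
def wave (ι : ℕ) (σ s : ℝ) (g : Lp ℂ 2 (volume : Measure E3)) : E3 → ℂ :=
  𝓕⁻ (waveFreq ι σ s g)

/-- The mixed norm `‖u‖_{L^p([t₀,t]; L^r(ℝ³))}` for `0 < p < ∞`. -/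
def mixedNorm (p : ℝ) (r : ℝ≥0∞) (t₀ t : ℝ) (u : ℝ → E3 → ℂ) : ℝ≥0∞ :=
  (∫⁻ s in Set.Icc t₀ t, eLpNorm (u s) r volume ^ p) ^ (1 / p)

/-- `⟨x⟩ = (1 + |x|²)^{1/2}`. -/
def japaneseBracket (x : E3) : ℝ := Real.sqrt (1 + ‖x‖ ^ 2)

theorem IsCutoff.contDiff_comp_norm {ψ : ℝ → ℝ} (hψ : IsCutoff ψ) {c : ℝ} (hc : 0 < c) :
    ContDiff ℝ ∞ (fun ξ : E3 => ψ (c * ‖ξ‖)) := by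
  rw [contDiff_iff_contDiffAt]
  intro x
  by_cases hx : x = 0
  · subst hx
    have hev : (fun ξ : E3 => ψ (c * ‖ξ‖)) =ᶠ[nhds 0] fun _ => (1 : ℝ) := by
      filter_upwards [Metric.ball_mem_nhds (0 : E3) (show 0 < 1 / c by positivity)] with ξ hξ
      rw [mem_ball_zero_iff, lt_div_iff₀ hc] at hξ
      have h0 : 0 ≤ c * ‖ξ‖ := by positivity
      exact hψ.eq_one _ ⟨by linarith, by linarith⟩
    exact contDiffAt_const.congr_of_eventuallyEq hev
  · exact hψ.smooth.contDiffAt.comp x (contDiffAt_const.mul (contDiffAt_norm ℝ hx))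

theorem IsCutoff.hasCompactSupport_comp_norm {ψ : ℝ → ℝ} (hψ : IsCutoff ψ) {c : ℝ} (hc : 0 < c) :
    HasCompactSupport (fun ξ : E3 => ψ (c * ‖ξ‖)) := by
  refine HasCompactSupport.intro (isCompact_closedBall (0 : E3) (8 / 5 / c)) fun x hx => ?_
  rw [mem_closedBall_zero_iff, not_le, div_lt_iff₀ hc] at hx
  exact hψ.eq_zero _ fun h => by linarith [h.2]

/-- The symbol of `P_k` is smooth and compactly supported, hence a genuine multiplier. -/
theorem IsCutoff.hasTemperateGrowth_dyadic {ψ : ℝ → ℝ} (hψ : IsCutoff ψ) (k : ℤ) :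
    (fun η : E3 => (dyadic ψ k ((2 * Real.pi) • η) : ℂ)).HasTemperateGrowth := by
  have key : ∀ c : ℝ, 0 < c → (fun η : E3 => ψ (c * ‖η‖)).HasTemperateGrowth := fun c hc =>
    (hψ.hasCompactSupport_comp_norm hc).hasTemperateGrowth (hψ.contDiff_comp_norm hc)
  have hpi : (0 : ℝ) < 2 * Real.pi := by positivity
  have hreal : (fun η : E3 => dyadic ψ k ((2 * Real.pi) • η)).HasTemperateGrowth := by
    unfold dyadic
    by_cases hk : k = -1
    · simp only [hk, if_true, norm_smul, Real.norm_of_nonneg hpi.le, ← mul_assoc]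
      exact key _ (by positivity)
    · simp only [hk, if_false, norm_smul, Real.norm_of_nonneg hpi.le, mul_div_right_comm]
      exact (key _ (by positivity)).sub (key _ (by positivity))
  exact Function.HasTemperateGrowth.comp Function.Complex.hasTemperateGrowth_ofReal hreal

end

/-! The evolution is cut in three ways: in frequency, `|ξ| ~ l = 2^(k+1-n)` with `n ≥ 0`; in the
position of the data, `⟨y⟩ ~ R = 2^j`; and in space-time, `1 + s + |x| ~ T = 2^m`. On a piece both
weights are essentially constant, so what is needed is an estimate for one piece that leaves
geometric decay in `m`, `j` and `n`.

Kernel. In three dimensions a radial Fourier integral collapses to one dimension: `|z|` times the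
frequency-localised kernel is a difference of one Schwartz profile at `s + |z|` and at `s - |z|`
(`waveKernel_radial`). This gives decay `1 / (1 + |s| + |z|)` together with concentration near the
light cone (`exists_waveKernel_bound`); scaling gives all frequencies `l`.

One piece. `exists_shell_strichartz` bounds the squared `L²_s L^∞_x` norm by `l² (lR)^(2θ)
(lT)^(2κ)` whenever `0 < θ < 1` and `-θ/2 < κ < 0`. For `lT > 1` two bounds compete. The endpoint
Strichartz bound, with a factor `log(lT)`, comes from Selberg's inequality for wave packets at times
`1/l` apart: their Gram entries are `O(l³ / (1 + |i - j|))`, so the row sums are harmonic. If `T` is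
much larger than `R`, Cauchy-Schwarz in `y` gains `(lR)²/(lT)`, because a spherical shell of
thickness `1/l` meets a ball of radius `R` in volume `O(R²/l)`. With `y = (lR)²/(lT)` the better of
the two is at most a constant times `y^θ (lT)^(2κ+θ)`, and the positive power `2κ + θ` pays for the
logarithm. For `lT ≤ 1` Cauchy-Schwarz suffices, with the volume of the ball used as well when `lR <
1`.

Summation. Interpolation with the uniform `L²_x` bound gives every `p ≥ 2`. Taking `θ` slightly
below `β₂` makes the sum over `j` converge, and `κ` slightly below `-β₁/2` the sum over `m`. The sum
over low frequencies converges when `ι p < 2 + 2θ + 2κ`, which is the origin of the range `p < 2 +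
2β₂ - β₁` for `ι = 1`. -/

noncomputable section

/-! ### Radial Fourier integrals on three-dimensional space -/

/-- The measurable identification `ℝ³ ≃ ℝ × ℝ²` splitting off the first coordinate. -/
def splitFirst : E3 ≃ᵐ ℝ × EuclideanSpace ℝ (Fin 2) :=
  ((MeasurableEquiv.toLp 2 (Fin 3 → ℝ)).symm.trans
    (MeasurableEquiv.piFinSuccAbove (fun _ : Fin 3 => ℝ) 0)).trans
    ((MeasurableEquiv.refl ℝ).prodCongr (MeasurableEquiv.toLp 2 (Fin 2 → ℝ)))

theorem measurePreserving_splitFirst : MeasurePreserving splitFirst volume volume := by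
  have h1 := EuclideanSpace.volume_preserving_symm_measurableEquiv_toLp (Fin 3)
  have h2 := volume_preserving_piFinSuccAbove (fun _ : Fin 3 => ℝ) 0
  have h3 := (EuclideanSpace.volume_preserving_symm_measurableEquiv_toLp (Fin 2)).symm
  exact ((MeasurePreserving.id (volume : Measure ℝ)).prod h3).comp (h2.comp h1)

theorem splitFirst_fst (η : E3) : (splitFirst η).1 = η 0 := rfl

theorem norm_eq_splitFirst (η : E3) :
    ‖η‖ = √((splitFirst η).1 ^ 2 + ‖(splitFirst η).2‖ ^ 2) := by
  rw [EuclideanSpace.norm_eq, EuclideanSpace.norm_eq, Real.sq_sqrt (by positivity),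
    Fin.sum_univ_three, Fin.sum_univ_two]
  simp [splitFirst, MeasurableEquiv.piFinSuccAbove, MeasurableEquiv.prodCongr,
    Fin.insertNthEquiv]
  congr 1
  rw [add_assoc]
  rfl

/-- A radial integral over the plane at height `t`, in terms of an antiderivative of `ρ G(ρ)`. -/
theorem integral_radial_plane {G A : ℝ → ℂ} {d : ℝ} (hG : Continuous G)
    (hGd : ∀ ρ, d < ρ → G ρ = 0) (hA : ∀ ρ, HasDerivAt A (-(G ρ * ρ)) ρ)
    (hAd : ∀ ρ, d ≤ ρ → A ρ = 0) (t : ℝ) :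
    ∫ y : EuclideanSpace ℝ (Fin 2), G (√(t ^ 2 + ‖y‖ ^ 2)) = 2 * Real.pi * A |t| := by
  have h := integral_fun_norm_addHaar (volume : Measure (EuclideanSpace ℝ (Fin 2)))
    (fun y : ℝ => G (√(t ^ 2 + y ^ 2)))
  rw [h]
  have hle : ∀ y : ℝ, y ≤ √(t ^ 2 + y ^ 2) := fun y =>
    Real.le_sqrt_of_sq_le (by nlinarith [sq_nonneg t])
  have hcont : Continuous fun y : ℝ => (y : ℂ) * G (√(t ^ 2 + y ^ 2)) := by fun_prop
  have hintegrable : IntegrableOn (fun y : ℝ => (y : ℂ) * G (√(t ^ 2 + y ^ 2))) (Set.Ioi 0) := by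
    refine (hcont.integrable_of_hasCompactSupport ?_).integrableOn
    refine HasCompactSupport.intro (isCompact_Icc (a := -|d|) (b := |d|)) fun y hy => ?_
    have : |d| < |y| := by
      by_contra hc
      exact hy (abs_le.1 (not_lt.1 hc))
    rw [hGd, mul_zero]
    refine lt_of_le_of_lt (le_abs_self d) (this.trans_le ?_)
    rw [← sq_abs y]
    exact hle _
  -- With `ρ = √(t² + y²)` one has `ρ dρ = y dy`, so the polar integrand is an exact derivative.
  -- Only the lower endpoint `ρ = |t|` contributes, since `A` vanishes beyond `d`.
  have key := integral_Ioi_of_hasDerivAt_of_tendsto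
    (f := fun y : ℝ => -A (√(t ^ 2 + y ^ 2))) (a := 0) (m := 0) (f' := fun y : ℝ =>
      (y : ℂ) * G (√(t ^ 2 + y ^ 2))) ?_ ?_ hintegrable ?_
  · have hvol : (volume : Measure (EuclideanSpace ℝ (Fin 2))).real (Metric.ball 0 1) = Real.pi := by
      simp [Measure.real, Real.pi_pos.le]
    simp only [finrank_euclideanSpace, Fintype.card_fin, hvol]
    have : ∀ y : ℝ, y ^ (2 - 1) • G (√(t ^ 2 + y ^ 2)) = (y : ℂ) * G (√(t ^ 2 + y ^ 2)) := by
      intro y; simp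
    simp only [this, key]
    simp [Real.sqrt_sq_eq_abs]
    ring
  · have : Continuous A := continuous_iff_continuousAt.2 fun ρ => (hA ρ).continuousAt
    exact Continuous.continuousWithinAt (by fun_prop)
  · intro y hy
    have hy : 0 < y := hy
    have hpos : 0 < t ^ 2 + y ^ 2 := by positivity
    have h1 : HasDerivAt (fun y : ℝ => √(t ^ 2 + y ^ 2)) (y / √(t ^ 2 + y ^ 2)) y := by
      have := ((hasDerivAt_pow 2 y).const_add (t ^ 2)).sqrt hpos.ne'
      convert this using 1
      field_simp
      norm_num [mul_comm]
    refine HasDerivAt.congr_deriv (f := fun y : ℝ => -A (√(t ^ 2 + y ^ 2)))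
      ((hA _).scomp y h1).neg ?_
    have : (√(t ^ 2 + y ^ 2) : ℝ) ≠ 0 := (Real.sqrt_pos.2 hpos).ne'
    have h3 : ((√(t ^ 2 + y ^ 2) : ℝ) : ℂ) ≠ 0 := by exact_mod_cast this
    rw [Complex.real_smul]
    push_cast
    field_simp
  · refine tendsto_const_nhds.congr' ?_
    filter_upwards [Filter.eventually_ge_atTop d] with y hy
    rw [hAd _ (hy.trans (hle y)), neg_zero]

/-- The three-dimensional Fourier integral of a radial function in an axis direction. -/
theorem integral_axis_mul_radial {G A f : ℝ → ℂ} {d : ℝ} (hf : Continuous f) (hG : Continuous G)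
    (hGd : ∀ ρ, d < ρ → G ρ = 0) (hA : ∀ ρ, HasDerivAt A (-(G ρ * ρ)) ρ)
    (hAd : ∀ ρ, d ≤ ρ → A ρ = 0) :
    ∫ η : E3, f (η 0) * G ‖η‖ = 2 * Real.pi * ∫ t : ℝ, f t * A |t| := by
  have h1 : ∫ η : E3, f (η 0) * G ‖η‖ = ∫ q : ℝ × EuclideanSpace ℝ (Fin 2),
      f q.1 * G (√(q.1 ^ 2 + ‖q.2‖ ^ 2)) := by
    rw [← measurePreserving_splitFirst.integral_comp']
    simp only [norm_eq_splitFirst, splitFirst_fst]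
  have hintegrable : Integrable (fun q : ℝ × EuclideanSpace ℝ (Fin 2) =>
      f q.1 * G (√(q.1 ^ 2 + ‖q.2‖ ^ 2))) := by
    refine Continuous.integrable_of_hasCompactSupport (by fun_prop) ?_
    refine HasCompactSupport.intro (isCompact_closedBall 0 |d|) fun q hq => ?_
    rw [mem_closedBall_zero_iff, not_le, Prod.norm_def] at hq
    rw [hGd, mul_zero]
    refine lt_of_le_of_lt (le_abs_self d) (hq.trans_le (max_le ?_ ?_))
    · exact Real.le_sqrt_of_sq_le (by rw [Real.norm_eq_abs, sq_abs]; nlinarith [sq_nonneg ‖q.2‖])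
    · exact Real.le_sqrt_of_sq_le (by nlinarith [sq_nonneg q.1])
  rw [h1, Measure.volume_eq_prod, integral_prod _ hintegrable, ← integral_const_mul]
  congr 1
  ext t
  simp only [integral_const_mul, integral_radial_plane hG hGd hA hAd]
  ring

/-! ### Wave packets and the half-wave kernel -/

/-- A smooth amplitude with compact support in `(0, ∞)`. -/
structure IsAmplitude (a : ℝ → ℝ) : Prop where
  smooth : ContDiff ℝ ∞ a
  exists_support : ∃ c d : ℝ, 0 < c ∧ c < d ∧ ∀ ρ, ρ ∉ Set.Icc c d → a ρ = 0

theorem IsAmplitude.sq {a : ℝ → ℝ} (ha : IsAmplitude a) : IsAmplitude (fun ρ => a ρ ^ 2) := by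
  obtain ⟨c, d, hc, hcd, h⟩ := ha.exists_support
  exact ⟨ha.smooth.pow 2, c, d, hc, hcd, fun ρ hρ => by simp [h ρ hρ]⟩

theorem IsAmplitude.dilate {a : ℝ → ℝ} (ha : IsAmplitude a) {l : ℝ} (hl : 0 < l) :
    IsAmplitude (fun ρ => a (ρ / l)) := by
  obtain ⟨c, d, hc, hcd, h⟩ := ha.exists_support
  refine ⟨ha.smooth.comp (contDiff_id.div_const l), l * c, l * d, by positivity,
    by gcongr, fun ρ hρ => h _ fun h' => hρ ?_⟩
  rw [Set.mem_Icc, le_div_iff₀ hl, div_le_iff₀ hl] at h'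
  exact ⟨by linarith [h'.1], by linarith [h'.2]⟩

theorem IsAmplitude.exists_bound {a : ℝ → ℝ} (ha : IsAmplitude a) :
    ∃ C, 0 < C ∧ ∀ ρ, |a ρ| ≤ C := by
  obtain ⟨c, d, hc, hcd, h⟩ := ha.exists_support
  obtain ⟨C, hC⟩ := isCompact_Icc.exists_bound_of_continuousOn (s := Set.Icc c d)
    ha.smooth.continuous.continuousOn
  refine ⟨max C 1, by positivity, fun ρ => ?_⟩
  by_cases hρ : ρ ∈ Set.Icc c d
  · exact (hC ρ hρ).trans (le_max_left _ _)
  · rw [h ρ hρ, abs_zero]; positivity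

/-- The phase `exp(2πi(z·η + s|η|))`. -/
def wavePhase (s : ℝ) (z η : E3) : ℂ :=
  Complex.exp (2 * Real.pi * Complex.I * ((inner ℝ z η + s * ‖η‖ : ℝ) : ℂ))

theorem norm_wavePhase (s : ℝ) (z η : E3) : ‖wavePhase s z η‖ = 1 := by
  rw [wavePhase, show 2 * (Real.pi : ℂ) * Complex.I * ((inner ℝ z η + s * ‖η‖ : ℝ) : ℂ) =
    ((2 * Real.pi * (inner ℝ z η + s * ‖η‖) : ℝ) : ℂ) * Complex.I by push_cast; ring,
    Complex.norm_exp_ofReal_mul_I]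

theorem continuous_wavePhase (s : ℝ) (z : E3) : Continuous (wavePhase s z) := by
  unfold wavePhase; fun_prop

theorem wavePhase_add (s s' : ℝ) (z z' η : E3) :
    wavePhase (s + s') (z + z') η = wavePhase s z η * wavePhase s' z' η := by
  rw [wavePhase, wavePhase, wavePhase, ← Complex.exp_add]
  congr 1
  rw [inner_add_left]
  push_cast
  ring

theorem star_wavePhase (s : ℝ) (z η : E3) :
    (starRingEnd ℂ) (wavePhase s z η) = wavePhase (-s) (-z) η := by
  rw [wavePhase, wavePhase, ← Complex.exp_conj]
  simp only [map_mul, Complex.conj_I, Complex.conj_ofReal, inner_neg_left, map_ofNat]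
  congr 1
  push_cast
  ring

/-- The function `η ↦ exp(2πi(z·η + s|η|)) a(|η|)`. -/
def wavePacketFun (a : ℝ → ℝ) (s : ℝ) (z η : E3) : ℂ := wavePhase s z η * a ‖η‖

theorem IsAmplitude.contDiff_wavePacketFun {a : ℝ → ℝ} (ha : IsAmplitude a) (s : ℝ) (z : E3) :
    ContDiff ℝ ∞ (wavePacketFun a s z) := by
  obtain ⟨c, d, hc, hcd, h⟩ := ha.exists_support
  rw [contDiff_iff_contDiffAt]
  intro x
  by_cases hx : x = 0
  · subst hx
    have hev : wavePacketFun a s z =ᶠ[nhds 0] fun _ => (0 : ℂ) := by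
      filter_upwards [Metric.ball_mem_nhds (0 : E3) hc] with ξ hξ
      rw [mem_ball_zero_iff] at hξ
      rw [wavePacketFun, h _ fun h' => by linarith [h'.1]]
      simp
    exact contDiffAt_const.congr_of_eventuallyEq hev
  · have hn : ContDiffAt ℝ ∞ (fun η : E3 => ‖η‖) x := contDiffAt_norm ℝ hx
    have h1 : ContDiffAt ℝ ∞ (fun η : E3 => ((inner ℝ z η + s * ‖η‖ : ℝ) : ℂ)) x :=
      Complex.ofRealCLM.contDiff.contDiffAt.comp x
        ((contDiff_const.inner ℝ contDiff_id).contDiffAt.add (contDiffAt_const.mul hn))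
    have h2 : ContDiffAt ℝ ∞ (fun η : E3 => (a ‖η‖ : ℂ)) x :=
      Complex.ofRealCLM.contDiff.contDiffAt.comp x (ha.smooth.contDiffAt.comp x hn)
    exact ((contDiffAt_const.mul h1).cexp).mul h2

theorem IsAmplitude.hasCompactSupport_wavePacketFun {a : ℝ → ℝ} (ha : IsAmplitude a) (s : ℝ)
    (z : E3) : HasCompactSupport (wavePacketFun a s z) := by
  obtain ⟨c, d, hc, hcd, h⟩ := ha.exists_support
  refine HasCompactSupport.intro (isCompact_closedBall (0 : E3) d) fun x hx => ?_
  rw [mem_closedBall_zero_iff, not_le] at hx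
  rw [wavePacketFun, h _ fun h' => by linarith [h'.2]]
  simp

/-- `wavePacketFun` as a Schwartz function. -/
def wavePacket {a : ℝ → ℝ} (ha : IsAmplitude a) (s : ℝ) (z : E3) : 𝓢(E3, ℂ) :=
  (ha.hasCompactSupport_wavePacketFun s z).toSchwartzMap (ha.contDiff_wavePacketFun s z)

theorem wavePacket_apply {a : ℝ → ℝ} (ha : IsAmplitude a) (s : ℝ) (z η : E3) :
    wavePacket ha s z η = wavePhase s z η * a ‖η‖ := rfl

/-- The frequency-localised half-wave kernel. -/
def waveKernel (a : ℝ → ℝ) (s : ℝ) (z : E3) : ℂ := ∫ η, wavePacketFun a s z η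

theorem fourierInv_wavePacket {a : ℝ → ℝ} (ha : IsAmplitude a) (s : ℝ) (z y : E3) :
    𝓕⁻ (wavePacket ha s z) y = waveKernel a s (y + z) := by
  rw [SchwartzMap.fourierInv_coe, Real.fourierInv_eq', waveKernel]
  congr 1
  ext η
  rw [wavePacket_apply, wavePacketFun, smul_eq_mul, ← mul_assoc]
  congr 1
  rw [wavePhase, wavePhase, ← Complex.exp_add, inner_add_left, real_inner_comm]
  congr 1
  push_cast
  ring

theorem continuous_waveKernel {a : ℝ → ℝ} (ha : IsAmplitude a) (s : ℝ) :
    Continuous (waveKernel a s) := by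
  have : waveKernel a s = 𝓕⁻ (wavePacket ha s 0) := by
    ext y; rw [fourierInv_wavePacket, add_zero]
  rw [this]
  exact SchwartzMap.continuous _

theorem waveKernel_isometry (a : ℝ → ℝ) (s : ℝ) (e : E3 ≃ₗᵢ[ℝ] E3) (z : E3) :
    waveKernel a s (e z) = waveKernel a s z := by
  rw [waveKernel, waveKernel, ← e.measurePreserving.integral_comp
    e.toHomeomorph.measurableEmbedding]
  congr 1
  ext η
  simp [wavePacketFun, wavePhase]

theorem waveKernel_eq_axis (a : ℝ → ℝ) (s : ℝ) (z : E3) :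
    waveKernel a s z = waveKernel a s (EuclideanSpace.single 0 ‖z‖) := by
  -- Two vectors of equal norm are exchanged by a reflection, which leaves the kernel invariant.
  have h : ‖z‖ = ‖(EuclideanSpace.single 0 ‖z‖ : E3)‖ := by simp
  rw [← Submodule.reflection_sub h, waveKernel_isometry]

theorem waveKernel_dilate (a : ℝ → ℝ) {l : ℝ} (hl : 0 < l) (s : ℝ) (z : E3) :
    waveKernel (fun ρ => a (ρ / l)) s z = (l : ℂ) ^ 3 * waveKernel a (l * s) (l • z) := by
  have h := Measure.integral_comp_smul (volume : Measure E3)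
    (wavePacketFun (fun ρ => a (ρ / l)) s z) l
  have h2 : ∀ η, wavePacketFun (fun ρ => a (ρ / l)) s z (l • η) =
      wavePacketFun a (l * s) (l • z) η := by
    intro η
    rw [wavePacketFun, wavePacketFun, wavePhase, wavePhase, norm_smul, Real.norm_of_nonneg hl.le,
      mul_div_cancel_left₀ _ hl.ne', inner_smul_left, inner_smul_right]
    congr 4
    simp
    ring
  simp only [h2] at h
  rw [waveKernel, waveKernel, h]
  simp only [finrank_euclideanSpace, Fintype.card_fin]
  rw [abs_of_pos (by positivity), Complex.real_smul]
  have : (l : ℂ) ≠ 0 := by exact_mod_cast hl.ne'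
  push_cast
  field_simp

/-! ### Dispersive decay of the kernel -/

theorem IsAmplitude.hasCompactSupport_mul_id {a : ℝ → ℝ} (ha : IsAmplitude a) :
    HasCompactSupport (fun ρ : ℝ => ((a ρ * ρ : ℝ) : ℂ)) := by
  obtain ⟨c, d, hc, hcd, h⟩ := ha.exists_support
  exact HasCompactSupport.intro (isCompact_Icc (a := c) (b := d)) fun x hx => by simp [h x hx]

theorem IsAmplitude.contDiff_mul_id {a : ℝ → ℝ} (ha : IsAmplitude a) :
    ContDiff ℝ ∞ (fun ρ : ℝ => ((a ρ * ρ : ℝ) : ℂ)) :=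
  Complex.ofRealCLM.contDiff.comp (ha.smooth.mul contDiff_id)

/-- The one-dimensional inverse Fourier transform of `ρ a(ρ)`. -/
def radialProfile {a : ℝ → ℝ} (ha : IsAmplitude a) : 𝓢(ℝ, ℂ) :=
  𝓕⁻ (ha.hasCompactSupport_mul_id.toSchwartzMap ha.contDiff_mul_id)

theorem radialProfile_apply {a : ℝ → ℝ} (ha : IsAmplitude a) (τ : ℝ) :
    radialProfile ha τ =
      ∫ ρ : ℝ, Complex.exp (2 * Real.pi * Complex.I * (τ * ρ)) * ((a ρ * ρ : ℝ) : ℂ) := by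
  rw [radialProfile, SchwartzMap.fourierInv_coe, Real.fourierInv_eq']
  congr 1
  ext ρ
  rw [smul_eq_mul]
  congr 2
  simp
  ring

/-- Integrating over planes orthogonal to `z` turns the kernel into the one-dimensional Fourier
integral of `2π A(|t|)`, where `A` is an antiderivative of `-ρ G(ρ)`. Multiplication by `‖z‖` then
corresponds to differentiating in `t`, which recovers the profile. -/
theorem waveKernel_radial {a : ℝ → ℝ} (ha : IsAmplitude a) (s : ℝ) (z : E3) :
    Complex.I * ‖z‖ * waveKernel a s z =
      radialProfile ha (s + ‖z‖) - radialProfile ha (s - ‖z‖) := by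
  obtain ⟨c, d, hc, hcd, hsupp⟩ := ha.exists_support
  set r := ‖z‖ with hr
  set G : ℝ → ℂ := fun ρ => Complex.exp (2 * Real.pi * Complex.I * (s * ρ)) * a ρ with hGdef
  have hacont := ha.smooth.continuous
  have hG : Continuous G := by rw [hGdef]; fun_prop
  have hGz : ∀ ρ, ρ ∉ Set.Icc c d → G ρ = 0 := fun ρ hρ => by simp [hGdef, hsupp ρ hρ]
  have hGd : ∀ ρ, d < ρ → G ρ = 0 := fun ρ hρ => hGz ρ fun h => by linarith [h.2]
  set β : ℝ → ℂ := fun ρ => G ρ * ρ with hβ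
  have hβc : Continuous β := by rw [hβ]; fun_prop
  have hβz : ∀ ρ, ρ ∉ Set.Icc c d → β ρ = 0 := fun ρ hρ => by simp [hβ, hGz ρ hρ]
  have hβi : ∀ u v, IntervalIntegrable β volume u v := fun u v => hβc.intervalIntegrable u v
  set A : ℝ → ℂ := fun ρ => -∫ w in d..ρ, β w with hAdef
  have hA : ∀ ρ, HasDerivAt A (-(G ρ * ρ)) ρ := fun ρ =>
    (intervalIntegral.integral_hasDerivAt_right (hβi _ _)
      hβc.stronglyMeasurable.stronglyMeasurableAtFilter hβc.continuousAt).neg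
  have hAd : ∀ ρ, d ≤ ρ → A ρ = 0 := by
    intro ρ hρ
    rw [hAdef]
    simp only [neg_eq_zero]
    refine intervalIntegral.integral_zero_ae (Filter.Eventually.of_forall fun w hw => ?_)
    rw [Set.uIoc_of_le hρ] at hw
    exact hβz w fun h => by linarith [h.2, hw.1]
  have hA0 : ∀ ρ, ρ ≤ 0 → A ρ = A 0 := by
    intro ρ hρ
    have h1 : ∫ w in ρ..0, β w = 0 := by
      refine intervalIntegral.integral_zero_ae (Filter.Eventually.of_forall fun w hw => ?_)
      rw [Set.uIoc_of_le hρ] at hw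
      exact hβz w fun h => by linarith [h.1, hw.2]
    have h2 := intervalIntegral.integral_add_adjacent_intervals (hβi d ρ) (hβi ρ 0)
    rw [h1, add_zero] at h2
    simp only [hAdef, h2]
  -- As `A` is constant on `(-∞, 0]`, this is a form of `A |t|` that is visibly differentiable at
  -- `0`.
  set B : ℝ → ℂ := fun t => A t + A (-t) - A 0 with hB
  have hAB : ∀ t, A |t| = B t := by
    intro t
    rcases le_total 0 t with ht | ht
    · simp [hB, abs_of_nonneg ht, hA0 (-t) (by linarith)]
    · simp [hB, abs_of_nonpos ht, hA0 t ht]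
  have hBd : ∀ t, HasDerivAt B (-β t + β (-t)) t := by
    intro t
    have h2 : HasDerivAt (fun t : ℝ => A (-t)) (β (-t)) t := by
      refine HasDerivAt.congr_deriv (f := fun t : ℝ => A (-t))
        ((hA (-t)).scomp t (hasDerivAt_neg t)) ?_
      simp [hβ]
    exact ((hA t).add h2).sub_const _
  have hderiv : deriv B = fun t => -β t + β (-t) := funext fun t => (hBd t).deriv
  have hβs : HasCompactSupport β := HasCompactSupport.intro isCompact_Icc hβz
  have hβint : Integrable β := hβc.integrable_of_hasCompactSupport hβs
  have hBc : Continuous B := continuous_iff_continuousAt.2 fun t => (hBd t).continuousAt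
  have hBs : HasCompactSupport B := by
    refine HasCompactSupport.intro (isCompact_Icc (a := -d) (b := d)) fun t ht => ?_
    rw [← hAB]
    refine hAd _ ?_
    by_contra hc'
    exact ht (abs_le.1 (not_le.1 hc').le)
  have hF := Real.fourier_deriv (hBc.integrable_of_hasCompactSupport hBs)
    (fun t => (hBd t).differentiableAt) (by rw [hderiv]; exact hβint.neg.add hβint.comp_neg)
  have hFr := congrFun hF (-r)
  rw [hderiv, Real.fourier_eq', Real.fourier_eq'] at hFr
  have hK : waveKernel a s z = 2 * Real.pi *
      ∫ t : ℝ, Complex.exp (2 * Real.pi * Complex.I * (r * t)) * B t := by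
    rw [waveKernel_eq_axis, ← hr]
    have := integral_axis_mul_radial (f := fun t : ℝ =>
      Complex.exp (2 * Real.pi * Complex.I * (r * t))) (by fun_prop) hG hGd hA hAd
    simp only [hAB] at this
    rw [← this, waveKernel]
    congr 1
    ext η
    rw [wavePacketFun, wavePhase, hGdef, ← mul_assoc, ← Complex.exp_add]
    congr 2
    simp [EuclideanSpace.inner_single_left]
    ring
  have hP : ∀ q : ℝ, radialProfile ha (s + q) =
      ∫ t : ℝ, Complex.exp (2 * Real.pi * Complex.I * (q * t)) * β t := by
    intro q
    rw [radialProfile_apply]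
    congr 1
    ext t
    rw [hβ, hGdef]
    simp only
    have e : Complex.exp (2 * Real.pi * Complex.I * (((s + q : ℝ) : ℂ) * t)) =
        Complex.exp (2 * Real.pi * Complex.I * (q * t)) *
          Complex.exp (2 * Real.pi * Complex.I * (s * t)) := by
      rw [← Complex.exp_add]
      congr 1
      push_cast
      ring
    rw [e]
    push_cast
    ring
  have hbi : ∀ q : ℝ, Integrable fun t : ℝ =>
      Complex.exp (2 * Real.pi * Complex.I * (q * t)) * β t := fun q =>
    Continuous.integrable_of_hasCompactSupport (by fun_prop) hβs.mul_left
  have hlhs : ∫ t : ℝ, Complex.exp (((-2 * Real.pi * inner ℝ t (-r) : ℝ) : ℂ) * Complex.I) •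
      (-β t + β (-t)) = -(radialProfile ha (s + r) - radialProfile ha (s - r)) := by
    rw [sub_eq_add_neg s r, hP, hP, neg_sub, ← integral_neg_eq_self (fun t : ℝ =>
      Complex.exp (2 * Real.pi * Complex.I * ((-r : ℝ) * t)) * β t), ← integral_sub
      (by simpa using (hbi (-r)).comp_neg) (hbi r)]
    congr 1
    ext t
    rw [show ((-2 * Real.pi * inner ℝ t (-r) : ℝ) : ℂ) * Complex.I =
      2 * Real.pi * Complex.I * (r * t) by simp; ring,
      show 2 * (Real.pi : ℂ) * Complex.I * (((-r : ℝ) : ℂ) * ((-t : ℝ) : ℂ)) =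
      2 * Real.pi * Complex.I * (r * t) by push_cast; ring, smul_eq_mul]
    ring
  rw [hlhs] at hFr
  have hrhs : ∫ t : ℝ, Complex.exp (((-2 * Real.pi * inner ℝ t (-r) : ℝ) : ℂ) * Complex.I) • B t =
      ∫ t : ℝ, Complex.exp (2 * Real.pi * Complex.I * (r * t)) * B t := by
    congr 1
    ext t
    rw [show ((-2 * Real.pi * inner ℝ t (-r) : ℝ) : ℂ) * Complex.I =
      2 * Real.pi * Complex.I * (r * t) by simp; ring, smul_eq_mul]
  rw [hrhs, smul_eq_mul] at hFr
  rw [hK]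
  have := congrArg Neg.neg hFr
  rw [neg_neg] at this
  rw [this]
  push_cast
  ring

/-- Three powers are exactly enough for the kernel bound: one is spent on replacing `‖z‖` by `1 +
|s| + ‖z‖`, and two remain for the distance to the cone. -/
theorem SchwartzMap.exists_decay_cube (f : 𝓢(ℝ, ℂ)) :
    ∃ C, 0 < C ∧ ∀ τ : ℝ, ‖f τ‖ ≤ C / (1 + |τ|) ^ 3 := by
  refine ⟨2 ^ 3 * ((Finset.Iic ((3, 0) : ℕ × ℕ)).sup fun m => SchwartzMap.seminorm ℂ m.1 m.2) f + 1,
    by positivity, fun τ => ?_⟩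
  have h := SchwartzMap.one_add_le_sup_seminorm_apply (𝕜 := ℂ) (m := (3, 0)) (k := 3) (n := 0)
    le_rfl le_rfl f τ
  rw [norm_iteratedFDeriv_zero, Real.norm_eq_abs] at h
  dsimp only at h
  rw [le_div_iff₀ (by positivity)]
  linarith

/-- Dispersive bound for the unit-frequency half-wave kernel. -/
theorem exists_waveKernel_bound {a : ℝ → ℝ} (ha : IsAmplitude a) :
    ∃ C, 0 < C ∧ ∀ (s : ℝ) (z : E3),
      ‖waveKernel a s z‖ ≤ C / ((1 + |s| + ‖z‖) * (1 + |(|s| - ‖z‖)|) ^ 2) := by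
  obtain ⟨C₀, hC₀, h0⟩ := SchwartzMap.exists_decay_cube (radialProfile ha)
  obtain ⟨C₁, hC₁, h1⟩ := SchwartzMap.exists_decay_cube
    (SchwartzMap.derivCLM ℂ ℂ (radialProfile ha))
  -- `8 * C₀` serves `‖z‖ ≥ 1`, where the profile itself decays. `128 * C₁` serves `‖z‖ < 1`, where
  -- the derivative of the profile is used.
  refine ⟨8 * C₀ + 128 * C₁, by positivity, fun s z => ?_⟩
  have main : ∀ z : E3, z ≠ 0 → ‖waveKernel a s z‖ ≤
      (8 * C₀ + 128 * C₁) / ((1 + |s| + ‖z‖) * (1 + |(|s| - ‖z‖)|) ^ 2) := by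
    intro z hz
    have hr : 0 < ‖z‖ := norm_pos_iff.2 hz
    have hid := congrArg norm (waveKernel_radial ha s z)
    rw [norm_mul, norm_mul, Complex.norm_I, one_mul, Complex.norm_real, norm_norm] at hid
    set r := ‖z‖ with hrdef
    set D := |(|s| - r)| with hD
    have hD0 : 0 ≤ D := abs_nonneg _
    have hs0 := abs_nonneg s
    have hD1 : |s| - r ≤ D := le_abs_self _
    have hD2 : D ≤ |s| + r := by
      rw [hD, abs_le]; constructor <;> linarith
    rw [le_div_iff₀ (by positivity)]
    rcases le_or_gt 1 r with h | h
    · have e1 : D ≤ |s + r| := by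
        have := abs_abs_sub_abs_le s (-r)
        rwa [abs_neg, abs_of_pos hr, sub_neg_eq_add] at this
      have e2 : D ≤ |s - r| := by
        have := abs_abs_sub_abs_le s r
        rwa [abs_of_pos hr] at this
      have b1 : ‖radialProfile ha (s + r)‖ ≤ C₀ / (1 + D) ^ 3 :=
        (h0 _).trans (by gcongr)
      have b2 : ‖radialProfile ha (s - r)‖ ≤ C₀ / (1 + D) ^ 3 :=
        (h0 _).trans (by gcongr)
      have b3 : r * ‖waveKernel a s z‖ * (1 + D) ^ 3 ≤ 2 * C₀ := by
        rw [hid, ← le_div_iff₀ (by positivity)]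
        refine (norm_sub_le _ _).trans ((add_le_add b1 b2).trans (le_of_eq ?_))
        ring
      have b4 : 1 + |s| + r ≤ 4 * (r * (1 + D)) := by nlinarith
      calc ‖waveKernel a s z‖ * ((1 + |s| + r) * (1 + D) ^ 2)
          ≤ ‖waveKernel a s z‖ * (4 * (r * (1 + D)) * (1 + D) ^ 2) := by gcongr
        _ = 4 * (r * ‖waveKernel a s z‖ * (1 + D) ^ 3) := by ring
        _ ≤ 8 * C₀ + 128 * C₁ := by linarith
    -- Near the spatial origin the mean value inequality produces a factor `2r` that cancels the `r`
    -- on the left.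
    · have b1 : ‖radialProfile ha (s + r) - radialProfile ha (s - r)‖ ≤
          8 * C₁ / (1 + |s|) ^ 3 * ‖(s + r) - (s - r)‖ := by
        refine (convex_Icc (s - r) (s + r)).norm_image_sub_le_of_norm_deriv_le (f := radialProfile ha)
          (fun x _ => (radialProfile ha).differentiableAt) (fun x hx => ?_)
          ⟨le_rfl, by linarith⟩ ⟨by linarith, le_rfl⟩
        have := h1 x
        rw [SchwartzMap.derivCLM_apply] at this
        refine this.trans ?_
        have hx1 : |s| ≤ |x| + 1 := by
          rcases abs_cases s with ⟨h1, h2⟩ | ⟨h1, h2⟩ <;> rcases abs_cases x with ⟨h3, h4⟩ | ⟨h3, h4⟩ <;>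
            linarith [hx.1, hx.2]
        have hx2 : 1 + |s| ≤ 2 * (1 + |x|) := by linarith [abs_nonneg x]
        rw [div_le_div_iff₀ (by positivity) (by positivity)]
        calc C₁ * (1 + |s|) ^ 3 ≤ C₁ * (2 * (1 + |x|)) ^ 3 := by gcongr
          _ = 8 * C₁ * (1 + |x|) ^ 3 := by ring
      rw [← hid, show s + r - (s - r) = 2 * r by ring, Real.norm_of_nonneg (by positivity)] at b1
      have b2 : ‖waveKernel a s z‖ ≤ 16 * C₁ / (1 + |s|) ^ 3 := by
        refine le_of_mul_le_mul_left (b1.trans (le_of_eq ?_)) hr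
        ring
      rw [le_div_iff₀ (by positivity)] at b2
      calc ‖waveKernel a s z‖ * ((1 + |s| + r) * (1 + D) ^ 2)
          ≤ ‖waveKernel a s z‖ * ((2 * (1 + |s|)) * (2 * (1 + |s|)) ^ 2) := by
            gcongr <;> linarith
        _ = 8 * (‖waveKernel a s z‖ * (1 + |s|) ^ 3) := by ring
        _ ≤ 8 * C₀ + 128 * C₁ := by linarith
  by_cases hz : z = 0
  -- At `z = 0` the radial identity carries no information; the bound is inherited by continuity.
  · have hcl : IsClosed {z : E3 | ‖waveKernel a s z‖ ≤
        (8 * C₀ + 128 * C₁) / ((1 + |s| + ‖z‖) * (1 + |(|s| - ‖z‖)|) ^ 2)} := by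
      have := continuous_waveKernel ha s
      refine isClosed_le (by fun_prop) (Continuous.div (by fun_prop) (by fun_prop) fun z => ?_)
      positivity
    have hd : Dense ({0}ᶜ : Set E3) := dense_compl_singleton 0
    exact hcl.closure_subset_iff.2 (fun w hw => main w hw) (hd z)
  · exact main z hz

/-! ### Volume of thin spherical shells inside a ball -/

/-- The substitution `ρ = √(t² + q)` has Jacobian `|t|/ρ ≥ 1/2` on the domain of integration. The
other factor `2` counts the two half-lines, on each of which the substitution is injective. -/
theorem lintegral_comp_sqrt_sq_add_le {F : ℝ → ℝ≥0∞} {q : ℝ} (hq : 0 ≤ q) :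
    ∫⁻ t in {t : ℝ | √(t ^ 2 + q) ≤ 2 * |t|}, F (√(t ^ 2 + q)) ≤ 4 * ∫⁻ ρ, F ρ := by
  set g : ℝ → ℝ := fun t => √(t ^ 2 + q) with hg
  have half : ∀ S : Set ℝ, MeasurableSet S → (∀ t ∈ S, t ≠ 0 ∧ g t ≤ 2 * |t|) → Set.InjOn g S →
      ∫⁻ t in S, F (g t) ≤ 2 * ∫⁻ ρ, F ρ := by
    intro S hS hS1 hinj
    have hpos : ∀ t ∈ S, 0 < t ^ 2 + q := fun t ht => by
      have := (hS1 t ht).1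
      positivity
    have hder : ∀ t ∈ S, HasDerivWithinAt g (t / g t) S t := by
      intro t ht
      refine ((((hasDerivAt_pow 2 t).add_const q).sqrt (hpos t ht).ne').congr_deriv
        ?_).hasDerivWithinAt (s := S)
      simp only [hg]
      field_simp
      norm_num [mul_comm]
    have h := lintegral_image_eq_lintegral_abs_deriv_mul hS hder hinj F
    calc ∫⁻ t in S, F (g t) ≤ ∫⁻ t in S, 2 * (ENNReal.ofReal |t / g t| * F (g t)) := by
          refine setLIntegral_mono' hS fun t ht => ?_
          have hgt : 0 < g t := Real.sqrt_pos.2 (hpos t ht)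
          have h1 : 1 ≤ 2 * |t / g t| := by
            rw [abs_div, abs_of_pos hgt, ← mul_div_assoc, one_le_div hgt]
            exact (hS1 t ht).2
          rw [← mul_assoc]
          refine le_mul_of_one_le_left' ?_
          rw [show (2 : ℝ≥0∞) = ENNReal.ofReal 2 by simp, ← ENNReal.ofReal_mul (by norm_num)]
          exact ENNReal.one_le_ofReal.2 h1
      _ = 2 * ∫⁻ t in S, ENNReal.ofReal |t / g t| * F (g t) :=
          lintegral_const_mul' _ _ (by simp)
      _ = 2 * ∫⁻ ρ in g '' S, F ρ := by rw [h]
      _ ≤ 2 * ∫⁻ ρ, F ρ := by gcongr; exact Measure.restrict_le_self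
  have hgm : Measurable g := by rw [hg]; fun_prop
  have hm : MeasurableSet {t : ℝ | g t ≤ 2 * |t|} :=
    measurableSet_le hgm (by fun_prop)
  have hp := half ({t : ℝ | g t ≤ 2 * |t|} ∩ Set.Ioi 0) (hm.inter measurableSet_Ioi)
    (fun t ht => ⟨(ne_of_gt ht.2), ht.1⟩) (by
      intro t ht u hu htu
      have ht : 0 < t := ht.2
      have hu : 0 < u := hu.2
      have := (Real.sqrt_inj (by positivity) (by positivity)).1 htu
      exact (sq_eq_sq₀ ht.le hu.le).1 (by linarith))
  have hn := half ({t : ℝ | g t ≤ 2 * |t|} ∩ Set.Iio 0) (hm.inter measurableSet_Iio)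
    (fun t ht => ⟨(ne_of_lt ht.2), ht.1⟩) (by
      intro t ht u hu htu
      have ht : t < 0 := ht.2
      have hu : u < 0 := hu.2
      have := (Real.sqrt_inj (by positivity) (by positivity)).1 htu
      have := (sq_eq_sq₀ (a := -t) (b := -u) (by linarith) (by linarith)).1 (by linarith)
      linarith)
  have hsub : {t : ℝ | g t ≤ 2 * |t|} ⊆ (({t : ℝ | g t ≤ 2 * |t|} ∩ Set.Ioi 0) ∪
      ({t : ℝ | g t ≤ 2 * |t|} ∩ Set.Iio 0)) ∪ {0} := by
    intro t ht
    rcases lt_trichotomy t 0 with h | h | h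
    · exact Or.inl (Or.inr ⟨ht, h⟩)
    · exact Or.inr h
    · exact Or.inl (Or.inl ⟨ht, h⟩)
  calc ∫⁻ t in {t : ℝ | g t ≤ 2 * |t|}, F (g t) ≤ _ := lintegral_mono_set hsub
    _ ≤ _ := lintegral_union_le _ _ _
    _ ≤ (_ + _) + _ := add_le_add_left (lintegral_union_le _ _ _) _
    _ ≤ (2 * (∫⁻ ρ, F ρ) + 2 * ∫⁻ ρ, F ρ) + 0 := by
        gcongr
        simp
    _ = 4 * ∫⁻ ρ, F ρ := by ring

/-- The part of a ball of radius `R` at distance about `ρ` from a given point has area `O(R²)`,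
in integrated form. -/
theorem lintegral_closedBall_comp_dist_le {F : ℝ → ℝ≥0∞} (hF : Measurable F) {R : ℝ} (hR : 0 ≤ R)
    (x : E3) :
    ∫⁻ y in Metric.closedBall (0 : E3) R, F ‖y - x‖ ≤
      ENNReal.ofReal (48 * R ^ 2) * ∫⁻ ρ, F ρ := by
  -- Where `|y i - x i|` is comparable to `‖y - x‖`, the `i`-th coordinate is traded for the
  -- distance `ρ`. The other two coordinates range over a square of area `(2R)²`, which gives `4 ·
  -- 4R²`.
  have part : ∀ i : Fin 3, ∫⁻ y in {y : E3 | ‖y‖ ≤ R ∧ ‖y - x‖ ≤ 2 * |y i - x i|}, F ‖y - x‖ ≤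
      ENNReal.ofReal (16 * R ^ 2) * ∫⁻ ρ, F ρ := by
    intro i
    set e : E3 ≃ᵐ ℝ × (Fin 2 → ℝ) := (MeasurableEquiv.toLp 2 (Fin 3 → ℝ)).symm.trans
      (MeasurableEquiv.piFinSuccAbove (fun _ : Fin 3 => ℝ) i) with he
    have hmp : MeasurePreserving e volume volume :=
      (volume_preserving_piFinSuccAbove (fun _ : Fin 3 => ℝ) i).comp
        (EuclideanSpace.volume_preserving_symm_measurableEquiv_toLp (Fin 3))
    have he1 : ∀ y, (e y).1 = y i := fun y => rfl
    have he2 : ∀ y l, (e y).2 l = y (i.succAbove l) := fun y l => rfl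
    set q : (Fin 2 → ℝ) → ℝ := fun w => ∑ l, (w l - x (i.succAbove l)) ^ 2 with hq
    have hq0 : ∀ w, 0 ≤ q w := fun w => Finset.sum_nonneg fun _ _ => sq_nonneg _
    have hqm : Measurable q := by rw [hq]; fun_prop
    set h : ℝ × (Fin 2 → ℝ) → ℝ≥0∞ := fun v =>
      (Metric.closedBall (0 : Fin 2 → ℝ) R).indicator 1 v.2 *
        {t : ℝ × (Fin 2 → ℝ) | √((t.1 - x i) ^ 2 + q t.2) ≤ 2 * |t.1 - x i|}.indicator
          (fun v => F (√((v.1 - x i) ^ 2 + q v.2))) v with hh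
    have hms : MeasurableSet
        {t : ℝ × (Fin 2 → ℝ) | √((t.1 - x i) ^ 2 + q t.2) ≤ 2 * |t.1 - x i|} :=
      measurableSet_le (by fun_prop) (by fun_prop)
    have hhm : Measurable h := by
      refine Measurable.mul ?_ (Measurable.indicator (by fun_prop) hms)
      exact (measurable_one.indicator Metric.isClosed_closedBall.measurableSet).comp measurable_snd
    have hnorm : ∀ y : E3, ‖y - x‖ = √(((e y).1 - x i) ^ 2 + q (e y).2) := by
      intro y
      rw [EuclideanSpace.norm_eq, Fin.sum_univ_succAbove _ i]
      simp [he1, he2, hq]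
    have hle : ∀ y : E3, {y : E3 | ‖y‖ ≤ R ∧ ‖y - x‖ ≤ 2 * |y i - x i|}.indicator
        (fun y => F ‖y - x‖) y ≤ h (e y) := by
      intro y
      refine Set.indicator_apply_le' (fun hy => ?_) (fun _ => zero_le)
      have h1 : (e y).2 ∈ Metric.closedBall (0 : Fin 2 → ℝ) R := by
        rw [mem_closedBall_zero_iff, pi_norm_le_iff_of_nonneg hR]
        intro l
        rw [he2]
        exact (PiLp.norm_apply_le y _).trans hy.1
      have h2 : e y ∈ {t : ℝ × (Fin 2 → ℝ) | √((t.1 - x i) ^ 2 + q t.2) ≤ 2 * |t.1 - x i|} := by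
        rw [Set.mem_ofPred_eq, ← hnorm, he1]
        exact hy.2
      simp only [hh]
      rw [Set.indicator_of_mem h1, Set.indicator_of_mem h2, ← hnorm]
      simp
    have hmS : MeasurableSet {y : E3 | ‖y‖ ≤ R ∧ ‖y - x‖ ≤ 2 * |y i - x i|} :=
      MeasurableSet.inter (s₁ := {y : E3 | ‖y‖ ≤ R}) (s₂ := {y : E3 | ‖y - x‖ ≤ 2 * |y i - x i|})
        (measurableSet_le (by fun_prop) (by fun_prop))
        (measurableSet_le (by fun_prop) (by fun_prop))
    rw [← lintegral_indicator hmS]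
    calc _ ≤ ∫⁻ y, h (e y) := lintegral_mono hle
      _ = ∫⁻ v, h v := hmp.lintegral_comp hhm
      _ = ∫⁻ w, ∫⁻ t, h (t, w) := by
          rw [Measure.volume_eq_prod, lintegral_prod_symm _ hhm.aemeasurable]
      _ ≤ ∫⁻ w, (Metric.closedBall (0 : Fin 2 → ℝ) R).indicator 1 w * (4 * ∫⁻ ρ, F ρ) := by
          refine lintegral_mono fun w => ?_
          simp only [hh]
          rw [lintegral_const_mul']
          swap
          · by_cases hw : w ∈ Metric.closedBall (0 : Fin 2 → ℝ) R <;> simp [hw]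
          gcongr
          have hsh := lintegral_sub_right_eq_self (μ := (volume : Measure ℝ)) (fun t : ℝ =>
            {t : ℝ | √(t ^ 2 + q w) ≤ 2 * |t|}.indicator (fun t => F (√(t ^ 2 + q w))) t) (x i)
          refine le_of_eq_of_le ?_ (lintegral_comp_sqrt_sq_add_le (F := F) (hq0 w))
          rw [← lintegral_indicator (measurableSet_le (by fun_prop) (by fun_prop)), ← hsh]
          rfl
      _ = ENNReal.ofReal (16 * R ^ 2) * ∫⁻ ρ, F ρ := by
          rw [lintegral_mul_const _
            (measurable_one.indicator Metric.isClosed_closedBall.measurableSet),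
            lintegral_indicator_one Metric.isClosed_closedBall.measurableSet,
            Real.volume_pi_closedBall _ hR, ← mul_assoc]
          congr 1
          rw [show (4 : ℝ≥0∞) = ENNReal.ofReal 4 by simp, ← ENNReal.ofReal_mul (by positivity)]
          congr 1
          simp
          ring
  -- Were all three coordinates of `y - x` smaller than `‖y - x‖ / 2`, their squares would add up to
  -- less than `3/4` of `‖y - x‖²`.
  have hcover : Metric.closedBall (0 : E3) R ⊆
      ⋃ i : Fin 3, {y : E3 | ‖y‖ ≤ R ∧ ‖y - x‖ ≤ 2 * |y i - x i|} := by
    intro y hy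
    rw [mem_closedBall_zero_iff] at hy
    by_contra hc
    simp only [Set.mem_iUnion, Set.mem_ofPred_eq, not_exists, not_and, not_le] at hc
    have h0 := fun i => hc i hy
    have hn := EuclideanSpace.norm_sq_eq (y - x)
    rw [Fin.sum_univ_three] at hn
    have hsq : ∀ i, 4 * ‖(y - x) i‖ ^ 2 < ‖y - x‖ ^ 2 := by
      intro i
      have := h0 i
      have e1 : ‖(y - x) i‖ = |y i - x i| := rfl
      rw [e1]
      nlinarith [abs_nonneg (y i - x i)]
    linarith [hsq 0, hsq 1, hsq 2, sq_nonneg ‖y - x‖]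
  calc _ ≤ _ := lintegral_mono_set hcover
    _ ≤ ∑' i : Fin 3, ∫⁻ y in {y : E3 | ‖y‖ ≤ R ∧ ‖y - x‖ ≤ 2 * |y i - x i|}, F ‖y - x‖ :=
        lintegral_iUnion_le _ _
    _ ≤ ∑' _ : Fin 3, ENNReal.ofReal (16 * R ^ 2) * ∫⁻ ρ, F ρ := ENNReal.tsum_le_tsum part
    _ = ENNReal.ofReal (48 * R ^ 2) * ∫⁻ ρ, F ρ := by
        rw [tsum_fintype, Finset.sum_const, Finset.card_univ, Fintype.card_fin, nsmul_eq_mul,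
          ← mul_assoc, show ((3 : ℕ) : ℝ≥0∞) = ENNReal.ofReal 3 by simp,
          ← ENNReal.ofReal_mul (by norm_num)]
        congr 2
        ring

theorem exists_lintegral_peak_bound :
    ∃ C, 0 < C ∧ ∀ l s : ℝ, 0 < l →
      ∫⁻ ρ : ℝ, ENNReal.ofReal (1 / (1 + l * |s - ρ|) ^ 4) ≤ ENNReal.ofReal (C / l) := by
  have hintegrable : Integrable (fun ρ : ℝ => 1 / (1 + |ρ|) ^ 4) := by
    have := integrable_one_add_norm (E := ℝ) (μ := volume) (r := 4) (by simp)
    refine this.congr (Filter.Eventually.of_forall fun ρ => ?_)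
    have h : (0 : ℝ) < 1 + |ρ| := by positivity
    simp only [Real.norm_eq_abs, Real.rpow_neg h.le, one_div]
    congr 1
    exact_mod_cast Real.rpow_natCast (1 + |ρ|) 4
  refine ⟨(∫ ρ : ℝ, 1 / (1 + |ρ|) ^ 4) + 1, ?_, fun l s hl => ?_⟩
  · have : 0 ≤ ∫ ρ : ℝ, 1 / (1 + |ρ|) ^ 4 := integral_nonneg fun ρ => by positivity
    linarith
  have hfun : (fun ρ : ℝ => 1 / (1 + l * |s - ρ|) ^ 4) =
      fun ρ : ℝ => (fun u : ℝ => (fun ρ : ℝ => 1 / (1 + |ρ|) ^ 4) (l * u)) (s - ρ) := by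
    ext ρ
    simp only [abs_mul, abs_of_pos hl]
  have hi1 : Integrable (fun ρ : ℝ => 1 / (1 + l * |s - ρ|) ^ 4) := by
    rw [hfun]
    exact (hintegrable.comp_mul_left' hl.ne').comp_sub_left s
  rw [← ofReal_integral_eq_lintegral_ofReal hi1
    (Filter.Eventually.of_forall fun ρ => by positivity)]
  refine ENNReal.ofReal_le_ofReal ?_
  rw [hfun, integral_sub_left_eq_self (fun u : ℝ => (fun ρ : ℝ => 1 / (1 + |ρ|) ^ 4) (l * u)),
    Measure.integral_comp_mul_left (fun ρ : ℝ => 1 / (1 + |ρ|) ^ 4), abs_of_pos (by positivity),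
    smul_eq_mul, inv_mul_eq_div]
  gcongr
  linarith

/-- The fourth power is the square of the quadratic concentration in the kernel bound. The integrand
is essentially the indicator of a shell of thickness `1/l`, of which the ball sees area at most
`O(R²)`. -/
theorem exists_shell_bound :
    ∃ C, 0 < C ∧ ∀ (l s R : ℝ) (x : E3), 0 < l → 0 ≤ R →
      ∫⁻ y in Metric.closedBall (0 : E3) R, ENNReal.ofReal (1 / (1 + l * |s - ‖y - x‖|) ^ 4) ≤
        ENNReal.ofReal (C * R ^ 2 / l) := by
  obtain ⟨C, hC, h⟩ := exists_lintegral_peak_bound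
  refine ⟨48 * C, by positivity, fun l s R x hl hR => ?_⟩
  refine (lintegral_closedBall_comp_dist_le (F := fun ρ => ENNReal.ofReal
    (1 / (1 + l * |s - ρ|) ^ 4)) (by fun_prop) hR x).trans ?_
  refine (mul_le_mul_right (h l s hl) _).trans (le_of_eq ?_)
  rw [← ENNReal.ofReal_mul (by positivity)]
  congr 1
  ring

/-! ### Almost orthogonality -/

/-- Selberg's inequality, an almost-orthogonal form of Bessel's inequality. -/
theorem sum_norm_inner_sq_le {H ι : Type*} [NormedAddCommGroup H] [InnerProductSpace ℂ H]
    (I : Finset ι) (v : ι → H) (g : H) {M : ℝ}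
    (hM0 : 0 ≤ M) (hM : ∀ i ∈ I, ∑ j ∈ I, ‖inner ℂ (v i) (v j)‖ ≤ M) :
    ∑ i ∈ I, ‖inner ℂ (v i) g‖ ^ 2 ≤ M * ‖g‖ ^ 2 := by
  set c : ι → ℂ := fun i => inner ℂ (v i) g with hc
  set w : H := ∑ i ∈ I, c i • v i with hw
  set X : ℝ := ∑ i ∈ I, ‖c i‖ ^ 2 with hX
  have hX0 : 0 ≤ X := Finset.sum_nonneg fun _ _ => by positivity
  have h1 : inner ℂ w g = (X : ℂ) := by
    rw [hw, sum_inner, hX]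
    push_cast
    refine Finset.sum_congr rfl fun i _ => ?_
    rw [inner_smul_left, Complex.conj_mul']
  have h2 : X ≤ ‖w‖ * ‖g‖ := by
    have := norm_inner_le_norm (𝕜 := ℂ) w g
    rwa [h1, Complex.norm_real, Real.norm_of_nonneg hX0] at this
  -- Schur's test for the Gram matrix: each cross term is split by the arithmetic-geometric mean
  -- inequality, and the two halves agree by symmetry.
  have h3 : ‖w‖ ^ 2 ≤ M * X := by
    have e1 : ‖w‖ ^ 2 = ‖∑ i ∈ I, ∑ j ∈ I, (starRingEnd ℂ) (c i) * (c j * inner ℂ (v i) (v j))‖ := by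
      have : inner ℂ w w = ∑ i ∈ I, ∑ j ∈ I, (starRingEnd ℂ) (c i) * (c j * inner ℂ (v i) (v j)) := by
        rw [hw, sum_inner]
        refine Finset.sum_congr rfl fun i _ => ?_
        rw [inner_sum]
        exact Finset.sum_congr rfl fun j _ => by rw [inner_smul_left, inner_smul_right]
      rw [← this, inner_self_eq_norm_sq_to_K]
      simp
    have sym : ∑ i ∈ I, ∑ j ∈ I, ‖c j‖ ^ 2 * ‖inner ℂ (v i) (v j)‖ =
        ∑ i ∈ I, ∑ j ∈ I, ‖c i‖ ^ 2 * ‖inner ℂ (v i) (v j)‖ := by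
      rw [Finset.sum_comm]
      refine Finset.sum_congr rfl fun i _ => Finset.sum_congr rfl fun j _ => ?_
      rw [norm_inner_symm (v j) (v i)]
    have e2 : ∑ i ∈ I, ∑ j ∈ I, ‖c i‖ ^ 2 * ‖inner ℂ (v i) (v j)‖ ≤ M * X := by
      rw [hX, Finset.mul_sum]
      refine Finset.sum_le_sum fun i hi => ?_
      rw [← Finset.mul_sum, mul_comm]
      exact mul_le_mul_of_nonneg_right (hM i hi) (by positivity)
    rw [e1]
    calc _ ≤ ∑ i ∈ I, ∑ j ∈ I, ‖(starRingEnd ℂ) (c i) * (c j * inner ℂ (v i) (v j))‖ :=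
          (norm_sum_le _ _).trans (Finset.sum_le_sum fun i _ => norm_sum_le _ _)
      _ ≤ ∑ i ∈ I, ∑ j ∈ I, (‖c i‖ ^ 2 * ‖inner ℂ (v i) (v j)‖ / 2 +
            ‖c j‖ ^ 2 * ‖inner ℂ (v i) (v j)‖ / 2) := by
          refine Finset.sum_le_sum fun i _ => Finset.sum_le_sum fun j _ => ?_
          rw [norm_mul, norm_mul, RCLike.norm_conj]
          nlinarith [two_mul_le_add_sq ‖c i‖ ‖c j‖, norm_nonneg (inner ℂ (v i) (v j))]
      _ = (∑ i ∈ I, ∑ j ∈ I, ‖c i‖ ^ 2 * ‖inner ℂ (v i) (v j)‖) / 2 +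
          (∑ i ∈ I, ∑ j ∈ I, ‖c j‖ ^ 2 * ‖inner ℂ (v i) (v j)‖) / 2 := by
          simp only [Finset.sum_add_distrib, Finset.sum_div]
      _ ≤ M * X := by rw [sym]; linarith
  rcases hX0.eq_or_lt with h0 | hpos
  · rw [← h0]
    positivity
  · have : X * X ≤ M * ‖g‖ ^ 2 * X := by
      calc X * X ≤ (‖w‖ * ‖g‖) * (‖w‖ * ‖g‖) := by gcongr
        _ = ‖w‖ ^ 2 * ‖g‖ ^ 2 := by ring
        _ ≤ M * X * ‖g‖ ^ 2 := by gcongr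
        _ = M * ‖g‖ ^ 2 * X := by ring
    exact le_of_mul_le_mul_right this hpos

/-! ### The localised propagator on `L²` -/

/-- The frequency-localised half-wave propagator `a(|∇|/2π) e^{is|∇|}`, evaluated at `(s, x)`. -/
def halfWave {a : ℝ → ℝ} (ha : IsAmplitude a) (s : ℝ) (x : E3)
    (g : Lp ℂ 2 (volume : Measure E3)) : ℂ :=
  inner ℂ ((wavePacket ha (-s) (-x)).toLp 2 volume) (𝓕 g : Lp ℂ 2 (volume : Measure E3))

theorem integrable_packet_mul {a : ℝ → ℝ} (ha : IsAmplitude a) (s : ℝ) (x : E3) (g : Lp ℂ 2 (volume : Measure E3)) :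
    Integrable (fun η => wavePacketFun a s x η * g η) := by
  have h1 : MemLp (wavePacketFun a s x) 2 volume := (wavePacket ha s x).memLp 2 volume
  exact MemLp.integrable_mul h1 (Lp.memLp g)

theorem halfWave_eq_integral {a : ℝ → ℝ} (ha : IsAmplitude a) (s : ℝ) (x : E3) (g : Lp ℂ 2 (volume : Measure E3)) :
    halfWave ha s x g =
      ∫ η, wavePacketFun a s x η * (𝓕 g : Lp ℂ 2 (volume : Measure E3)) η := by
  rw [halfWave, L2.inner_def]
  refine integral_congr_ae ?_
  filter_upwards [(wavePacket ha (-s) (-x)).coeFn_toLp 2 volume] with η hη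
  rw [hη, wavePacket_apply, RCLike.inner_apply, map_mul, star_wavePhase, wavePacketFun,
    Complex.conj_ofReal, neg_neg, neg_neg]
  ring

/-- By Plancherel the pairing moves to physical space, where localisation of the data can be
exploited. -/
theorem halfWave_eq_integral_kernel {a : ℝ → ℝ} (ha : IsAmplitude a) (s : ℝ) (x : E3) (g : Lp ℂ 2 (volume : Measure E3)) :
    halfWave ha s x g = ∫ y, (starRingEnd ℂ) (waveKernel a (-s) (y - x)) * g y := by
  have h : (𝓕 ((𝓕⁻ (wavePacket ha (-s) (-x))).toLp 2 volume) : Lp ℂ 2 (volume : Measure E3)) =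
      (wavePacket ha (-s) (-x)).toLp 2 volume := by
    rw [SchwartzMap.toLp_fourier_eq, FourierTransform.fourier_fourierInv_eq]
  rw [halfWave, ← h, Lp.inner_fourier_eq, L2.inner_def]
  refine integral_congr_ae ?_
  filter_upwards [(𝓕⁻ (wavePacket ha (-s) (-x))).coeFn_toLp 2 volume] with y hy
  rw [hy, fourierInv_wavePacket, RCLike.inner_apply, ← sub_eq_add_neg]
  ring

theorem memLp_waveKernel {a : ℝ → ℝ} (ha : IsAmplitude a) (s : ℝ) (x : E3) :
    MemLp (fun y => (starRingEnd ℂ) (waveKernel a s (y - x))) 2 volume := by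
  have h := (𝓕⁻ (wavePacket ha s (-x))).memLp 2 volume
  have h2 : (⇑(𝓕⁻ (wavePacket ha s (-x))) : E3 → ℂ) = fun y => waveKernel a s (y - x) := by
    ext y; rw [fourierInv_wavePacket, ← sub_eq_add_neg]
  rw [h2] at h
  exact h.star

/-- The `TT*` identity: Gram entries of packets are again half-wave kernels, now with amplitude
`a²`, so kernel decay becomes almost orthogonality. -/
theorem inner_wavePacket {a : ℝ → ℝ} (ha : IsAmplitude a) (s s' : ℝ) (x x' : E3) :
    inner ℂ ((wavePacket ha s x).toLp 2 (volume : Measure E3))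
      ((wavePacket ha s' x').toLp 2 volume) =
      waveKernel (fun ρ => a ρ ^ 2) (s' - s) (x' - x) := by
  rw [L2.inner_def, waveKernel]
  refine integral_congr_ae ?_
  filter_upwards [(wavePacket ha s x).coeFn_toLp 2 volume,
    (wavePacket ha s' x').coeFn_toLp 2 volume] with η h1 h2
  rw [h1, h2, wavePacket_apply, wavePacket_apply, RCLike.inner_apply, map_mul, star_wavePhase,
    wavePacketFun, Complex.conj_ofReal, sub_eq_add_neg, sub_eq_add_neg, wavePhase_add]
  push_cast
  ring

theorem continuous_halfWave_time {a : ℝ → ℝ} (ha : IsAmplitude a) (x : E3) (g : Lp ℂ 2 (volume : Measure E3)) :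
    Continuous fun s => halfWave ha s x g := by
  simp only [halfWave_eq_integral]
  refine continuous_of_dominated (bound := fun η =>
    ‖wavePacketFun a 0 x η * (𝓕 g : Lp ℂ 2 (volume : Measure E3)) η‖)
    (fun s => (integrable_packet_mul ha s x _).aestronglyMeasurable)
    (fun s => Filter.Eventually.of_forall fun η => ?_)
    (integrable_packet_mul ha 0 x _).norm (Filter.Eventually.of_forall fun η => ?_)
  · simp [wavePacketFun, norm_wavePhase]
  · unfold wavePacketFun wavePhase; fun_prop

theorem continuous_halfWave_space {a : ℝ → ℝ} (ha : IsAmplitude a) (s : ℝ) (g : Lp ℂ 2 (volume : Measure E3)) :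
    Continuous fun x => halfWave ha s x g := by
  simp only [halfWave_eq_integral]
  refine continuous_of_dominated (bound := fun η =>
    ‖wavePacketFun a s 0 η * (𝓕 g : Lp ℂ 2 (volume : Measure E3)) η‖)
    (fun x => (integrable_packet_mul ha s x _).aestronglyMeasurable)
    (fun x => Filter.Eventually.of_forall fun η => ?_)
    (integrable_packet_mul ha s 0 _).norm (Filter.Eventually.of_forall fun η => ?_)
  · simp [wavePacketFun, norm_wavePhase]
  · unfold wavePacketFun wavePhase; fun_prop

theorem continuous_halfWave_data {a : ℝ → ℝ} (ha : IsAmplitude a) (s : ℝ) (x : E3) :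
    Continuous fun g => halfWave ha s x g :=
  continuous_const.inner (Lp.fourierTransformₗᵢ E3 ℂ).continuous

theorem norm_halfWave_le {a : ℝ → ℝ} (ha : IsAmplitude a) (s : ℝ) (x : E3)
    (g : Lp ℂ 2 (volume : Measure E3)) :
    ‖halfWave ha s x g‖ ^ 2 ≤ ‖waveKernel (fun ρ => a ρ ^ 2) 0 0‖ * ‖g‖ ^ 2 := by
  have h := norm_inner_le_norm (𝕜 := ℂ) ((wavePacket ha (-s) (-x)).toLp 2 (volume : Measure E3))
    (𝓕 g : Lp ℂ 2 (volume : Measure E3))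
  rw [Lp.norm_fourier_eq] at h
  have h2 := inner_wavePacket ha (-s) (-s) (-x) (-x)
  rw [sub_self, sub_self, inner_self_eq_norm_sq_to_K] at h2
  rw [← h2, norm_pow, RCLike.norm_ofReal, abs_norm, ← mul_pow]
  exact pow_le_pow_left₀ (norm_nonneg _) h 2

theorem eLpNorm_halfWave_toLp_le {a : ℝ → ℝ} (ha : IsAmplitude a) {C : ℝ} (hC : ∀ ρ, |a ρ| ≤ C)
    (s : ℝ) (f : 𝓢(E3, ℂ)) :
    eLpNorm (fun x => halfWave ha s x (f.toLp 2 volume)) 2 volume ≤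
      ENNReal.ofReal C * ‖f.toLp 2 (volume : Measure E3)‖ₑ := by
  have hcs : HasCompactSupport (fun η => wavePacketFun a s 0 η * (𝓕 f) η) :=
    (ha.hasCompactSupport_wavePacketFun s 0).mul_right
  have hsm : ContDiff ℝ ∞ (fun η => wavePacketFun a s 0 η * (𝓕 f) η) :=
    (ha.contDiff_wavePacketFun s 0).mul (SchwartzMap.smooth (𝓕 f) ⊤)
  set h : 𝓢(E3, ℂ) := hcs.toSchwartzMap hsm with hh
  -- For Schwartz data the evolution is itself the inverse Fourier transform of a Schwartz function,
  -- so Plancherel applies to honest functions.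
  have h1 : (fun x => halfWave ha s x (f.toLp 2 volume)) = ⇑(𝓕⁻ h : 𝓢(E3, ℂ)) := by
    ext x
    rw [halfWave_eq_integral, SchwartzMap.toLp_fourier_eq, SchwartzMap.fourierInv_coe,
      Real.fourierInv_eq']
    refine integral_congr_ae ?_
    filter_upwards [(𝓕 f).coeFn_toLp 2 volume] with η hη
    change _ = _ • (wavePacketFun a s 0 η * (𝓕 f) η)
    rw [hη, smul_eq_mul, ← mul_assoc]
    congr 1
    rw [wavePacketFun, wavePacketFun, ← mul_assoc]
    congr 1
    rw [wavePhase, wavePhase, ← Complex.exp_add, real_inner_comm]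
    congr 1
    simp
    ring
  have h2 : eLpNorm (⇑(𝓕⁻ h : 𝓢(E3, ℂ))) 2 volume = eLpNorm (⇑h) 2 volume := by
    have e1 : ∀ w : 𝓢(E3, ℂ), ‖w.toLp 2 (volume : Measure E3)‖ₑ = eLpNorm (⇑w) 2 volume := by
      intro w
      rw [Lp.enorm_def]
      exact eLpNorm_congr_ae (w.coeFn_toLp 2 volume)
    rw [← e1, ← e1, ← SchwartzMap.toLp_fourierInv_eq]
    have : ‖(𝓕⁻ (h.toLp 2 volume) : Lp ℂ 2 (volume : Measure E3))‖ = ‖h.toLp 2 volume‖ :=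
      (Lp.fourierTransformₗᵢ E3 ℂ).symm.norm_map _
    rw [← ofReal_norm, this, ofReal_norm]
  rw [h1, h2]
  have h3 : ‖f.toLp 2 (volume : Measure E3)‖ₑ = eLpNorm (⇑(𝓕 f : 𝓢(E3, ℂ))) 2 volume := by
    rw [← ofReal_norm, ← Lp.norm_fourier_eq, SchwartzMap.toLp_fourier_eq, ofReal_norm, Lp.enorm_def]
    exact eLpNorm_congr_ae ((𝓕 f).coeFn_toLp 2 volume)
  rw [h3]
  refine eLpNorm_le_mul_eLpNorm_of_ae_le_mul (Filter.Eventually.of_forall fun η => ?_) 2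
  change ‖wavePacketFun a s 0 η * (𝓕 f) η‖ ≤ _
  rw [norm_mul, wavePacketFun, norm_mul, norm_wavePhase, one_mul, Complex.norm_real]
  exact mul_le_mul_of_nonneg_right (hC _) (norm_nonneg _)

theorem eLpNorm_halfWave_le {a : ℝ → ℝ} (ha : IsAmplitude a) {C : ℝ} (hC : ∀ ρ, |a ρ| ≤ C)
    (s : ℝ) (g : Lp ℂ 2 (volume : Measure E3)) :
    eLpNorm (fun x => halfWave ha s x g) 2 volume ≤ ENNReal.ofReal C * ‖g‖ₑ := by
  have hd := SchwartzMap.denseRange_toLpCLM (E := E3) (F := ℂ) (p := 2)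
    (μ := (volume : Measure E3)) ENNReal.ofNat_ne_top
  obtain ⟨w, hw, hlim⟩ := mem_closure_iff_seq_limit.1 (hd g)
  choose f hf using hw
  have hf' : ∀ n, (f n).toLp 2 volume = w n := hf
  -- Schwartz data are dense, and the evolution depends continuously on the data at each point, so
  -- Fatou's lemma passes the bound to the limit.
  refine (Lp.eLpNorm_lim_le_liminf_eLpNorm (f := fun n x => halfWave ha s x (w n))
    (fun n => (continuous_halfWave_space ha s _).aestronglyMeasurable) _
    (Filter.Eventually.of_forall fun x =>
      ((continuous_halfWave_data ha s x).tendsto g).comp hlim)).trans ?_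
  have ht : Filter.Tendsto (fun n => ENNReal.ofReal C * ‖w n‖ₑ) Filter.atTop
      (nhds (ENNReal.ofReal C * ‖g‖ₑ)) :=
    ENNReal.Tendsto.const_mul ((continuous_enorm.tendsto g).comp hlim)
      (Or.inr ENNReal.ofReal_ne_top)
  rw [← ht.liminf_eq]
  refine Filter.liminf_le_liminf (Filter.Eventually.of_forall fun n => ?_)
  simp only [← hf']
  exact eLpNorm_halfWave_toLp_le ha hC s (f n)

/-! ### Localisation of the data and suprema over space-time shells -/

/-- The restriction of an `L²` function to a measurable set. -/
def cutLp {S : Set E3} (hS : MeasurableSet S) (g : Lp ℂ 2 (volume : Measure E3)) :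
    Lp ℂ 2 (volume : Measure E3) :=
  ((Lp.memLp g).indicator hS).toLp

theorem coeFn_cutLp {S : Set E3} (hS : MeasurableSet S) (g : Lp ℂ 2 (volume : Measure E3)) :
    cutLp hS g =ᵐ[volume] S.indicator g := MemLp.coeFn_toLp _

theorem enorm_cutLp {S : Set E3} (hS : MeasurableSet S) (g : Lp ℂ 2 (volume : Measure E3)) :
    ‖cutLp hS g‖ₑ = eLpNorm (S.indicator g) 2 volume := by
  rw [Lp.enorm_def]
  exact eLpNorm_congr_ae (coeFn_cutLp hS g)

theorem halfWave_cutLp {a : ℝ → ℝ} (ha : IsAmplitude a) {S : Set E3} (hS : MeasurableSet S)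
    (s : ℝ) (x : E3) (g : Lp ℂ 2 (volume : Measure E3)) :
    halfWave ha s x (cutLp hS g) =
      ∫ y in S, (starRingEnd ℂ) (waveKernel a (-s) (y - x)) * g y := by
  rw [halfWave_eq_integral_kernel, ← integral_indicator hS]
  refine integral_congr_ae ?_
  filter_upwards [coeFn_cutLp hS g] with y hy
  rw [hy]
  by_cases h : y ∈ S <;> simp [h]

theorem hasSum_halfWave_cutLp {a : ℝ → ℝ} (ha : IsAmplitude a) {S : ℕ → Set E3}
    (hS : ∀ j, MeasurableSet (S j)) (hd : Pairwise (Function.onFun Disjoint S))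
    (hU : ⋃ j, S j = Set.univ) (s : ℝ) (x : E3) (g : Lp ℂ 2 (volume : Measure E3)) :
    HasSum (fun j => halfWave ha s x (cutLp (hS j) g)) (halfWave ha s x g) := by
  simp only [halfWave_cutLp]
  have hintegrable : Integrable (fun y => (starRingEnd ℂ) (waveKernel a (-s) (y - x)) * g y) :=
    MemLp.integrable_mul (memLp_waveKernel ha _ _) (Lp.memLp g)
  have h := hasSum_integral_iUnion hS hd hintegrable.integrableOn
  rw [hU, Measure.restrict_univ, ← halfWave_eq_integral_kernel ha] at h
  exact h

/-- An uncountable supremum need not be measurable, but a supremum of continuous functions over open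
time sets is lower semicontinuous. This is the reason for the strict inequalities in `shellSup`. -/
theorem lowerSemicontinuous_biSup_enorm {v : ℝ → E3 → ℂ} (hv : ∀ x, Continuous fun s => v s x)
    {U : E3 → Set ℝ} (hU : ∀ x, IsOpen (U x)) :
    LowerSemicontinuous fun s => ⨆ x, ⨆ _ : s ∈ U x, ‖v s x‖ₑ := by
  refine lowerSemicontinuous_iSup fun x => lowerSemicontinuous_iff_isOpen_preimage.2 fun c => ?_
  have : (fun s => ⨆ _ : s ∈ U x, ‖v s x‖ₑ) ⁻¹' Set.Ioi c =
      U x ∩ (fun s => ‖v s x‖ₑ) ⁻¹' Set.Ioi c := by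
    ext s
    by_cases h : s ∈ U x <;> simp [h]
  rw [this]
  exact (hU x).inter (isOpen_Ioi.preimage (by have := hv x; fun_prop))

/-- The supremum of `|v(s, x)|` over the `x` with `T/2 < 1 + s + |x| < 2T`. -/
def shellSup (T : ℝ) (v : ℝ → E3 → ℂ) (s : ℝ) : ℝ≥0∞ :=
  ⨆ x : E3, ⨆ _ : s ∈ {s : ℝ | T / 2 < 1 + s + ‖x‖ ∧ 1 + s + ‖x‖ < 2 * T}, ‖v s x‖ₑ

theorem measurable_shellSup (T : ℝ) {v : ℝ → E3 → ℂ} (hv : ∀ x, Continuous fun s => v s x) :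
    Measurable (shellSup T v) := by
  have hU : ∀ x : E3, IsOpen {s : ℝ | T / 2 < 1 + s + ‖x‖ ∧ 1 + s + ‖x‖ < 2 * T} := by
    intro x
    have h1 : IsOpen {s : ℝ | T / 2 < 1 + s + ‖x‖} := isOpen_lt (by fun_prop) (by fun_prop)
    have h2 : IsOpen {s : ℝ | 1 + s + ‖x‖ < 2 * T} := isOpen_lt (by fun_prop) (by fun_prop)
    exact h1.inter h2
  exact (lowerSemicontinuous_biSup_enorm hv hU).measurable

theorem measurable_iSup_enorm {v : ℝ → E3 → ℂ} (hv : ∀ x, Continuous fun s => v s x) :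
    Measurable fun s => ⨆ x, ‖v s x‖ₑ := by
  have := (lowerSemicontinuous_biSup_enorm hv (U := fun _ => Set.univ)
    fun _ => isOpen_univ).measurable
  simpa using this

theorem shellSup_le_iSup (T : ℝ) (v : ℝ → E3 → ℂ) (s : ℝ) : shellSup T v s ≤ ⨆ x, ‖v s x‖ₑ :=
  iSup_mono fun _ => iSup_le fun _ => le_rfl

theorem lintegral_shellSup_sq (T : ℝ) (v : ℝ → E3 → ℂ) :
    ∫⁻ s in Set.Ici 0, shellSup T v s ^ 2 = ∫⁻ s in Set.Ico 0 (2 * T), shellSup T v s ^ 2 := by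
  rw [← lintegral_indicator measurableSet_Ici, ← lintegral_indicator measurableSet_Ico]
  congr 1
  ext s
  by_cases h0 : 0 ≤ s
  · by_cases h1 : s < 2 * T
    · rw [Set.indicator_of_mem (show s ∈ Set.Ici 0 from h0),
        Set.indicator_of_mem (show s ∈ Set.Ico 0 (2 * T) from ⟨h0, h1⟩)]
    · rw [Set.indicator_of_mem (show s ∈ Set.Ici 0 from h0),
        Set.indicator_of_notMem (fun h : s ∈ Set.Ico 0 (2 * T) => h1 h.2)]
      have : shellSup T v s = 0 := by
        refine le_antisymm (iSup_le fun x => iSup_le fun h => ?_) zero_le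
        exact absurd h.2 (by linarith [norm_nonneg x])
      rw [this]
      simp
  · rw [Set.indicator_of_notMem (fun h : s ∈ Set.Ici 0 => h0 h),
      Set.indicator_of_notMem (fun h : s ∈ Set.Ico 0 (2 * T) => h0 h.1)]

theorem lintegral_shellSup_sq_le {T : ℝ} {v : ℝ → E3 → ℂ} {B : ℝ≥0∞}
    (h : ∀ s x, 0 ≤ s → T / 2 < 1 + s + ‖x‖ → ‖v s x‖ₑ ^ 2 ≤ B) :
    ∫⁻ s in Set.Ici 0, shellSup T v s ^ 2 ≤ B * ENNReal.ofReal (2 * T) := by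
  rw [lintegral_shellSup_sq]
  calc _ ≤ ∫⁻ s in Set.Ico 0 (2 * T), B := by
        refine setLIntegral_mono' measurableSet_Ico fun s hs => ?_
        have : shellSup T v s ≤ B ^ (1 / 2 : ℝ) := by
          refine iSup_le fun x => iSup_le fun hx => ?_
          have h1 := h s x hs.1 hx.1
          have h2 := ENNReal.rpow_le_rpow h1 (show (0 : ℝ) ≤ 1 / 2 by norm_num)
          rwa [← ENNReal.rpow_natCast, ← ENNReal.rpow_mul, Nat.cast_ofNat, mul_one_div_cancel
            (by norm_num), ENNReal.rpow_one] at h2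
        have h2 := pow_le_pow_left₀ zero_le this 2
        rwa [← ENNReal.rpow_natCast (B ^ (1 / 2 : ℝ)), ← ENNReal.rpow_mul, Nat.cast_ofNat,
          one_div_mul_cancel (by norm_num), ENNReal.rpow_one] at h2
    _ = B * ENNReal.ofReal (2 * T) := by simp

/-- The maximising point may depend on the index, so the sum of suprema is a single supremum over
choice functions. Any two choices are dominated by a third, which makes the family directed. -/
theorem sum_iSup_le {ι X : Type*} [Nonempty X] (I : Finset ι) (F : ι → X → ℝ≥0∞) {B : ℝ≥0∞}
    (h : ∀ χ : ι → X, ∑ i ∈ I, F i (χ i) ≤ B) : ∑ i ∈ I, ⨆ x, F i x ≤ B := by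
  classical
  have h1 : ∀ i, ⨆ x, F i x = ⨆ χ : ι → X, F i (χ i) := fun i =>
    le_antisymm (iSup_le fun x => le_iSup (fun χ : ι → X => F i (χ i)) (fun _ => x))
      (iSup_le fun χ => le_iSup (F i) (χ i))
  simp only [h1]
  rw [ENNReal.finsetSum_iSup]
  · exact iSup_le h
  · intro χ χ'
    refine ⟨fun i => if F i (χ i) ≤ F i (χ' i) then χ' i else χ i, fun i => ?_⟩
    dsimp only
    split_ifs with hi
    · exact ⟨hi, le_rfl⟩
    · exact ⟨le_rfl, (not_le.1 hi).le⟩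

/-! ### Square-integral bounds in time for one piece -/

theorem sum_range_dist_le {N i : ℕ} (hi : i < N) :
    ∑ j ∈ Finset.range N, 1 / (1 + |(i : ℝ) - j|) ≤ 2 * (1 + Real.log N) := by
  have hH : ∑ m ∈ Finset.range N, 1 / (1 + (m : ℝ)) ≤ 1 + Real.log N := by
    have := harmonic_le_one_add_log N
    refine le_trans (le_of_eq ?_) this
    rw [harmonic]
    push_cast
    refine Finset.sum_congr rfl fun m _ => ?_
    rw [one_div, add_comm]
  have h1 : ∑ j ∈ Finset.range i, 1 / (1 + |(i : ℝ) - j|) ≤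
      ∑ m ∈ Finset.range N, 1 / (1 + (m : ℝ)) := by
    rw [← Finset.sum_range_reflect]
    refine le_trans (Finset.sum_le_sum (g := fun m : ℕ => 1 / (1 + (m : ℝ))) fun j hj => ?_)
      (Finset.sum_le_sum_of_subset_of_nonneg (Finset.range_subset_range.2 hi.le)
        fun _ _ _ => by positivity)
    have hj := Finset.mem_range.1 hj
    have : ((i - 1 - j : ℕ) : ℝ) = (i : ℝ) - 1 - j := by
      rw [Nat.cast_sub (by omega), Nat.cast_sub (by omega)]; simp
    rw [this]
    gcongr
    rw [show (i : ℝ) - ((i : ℝ) - 1 - j) = 1 + j by ring, abs_of_nonneg (by positivity)]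
    linarith
  have h2 : ∑ j ∈ Finset.Ico i N, 1 / (1 + |(i : ℝ) - j|) ≤
      ∑ m ∈ Finset.range N, 1 / (1 + (m : ℝ)) := by
    rw [Finset.sum_Ico_eq_sum_range]
    refine le_trans (le_of_eq ?_)
      (Finset.sum_le_sum_of_subset_of_nonneg (Finset.range_subset_range.2 (Nat.sub_le N i))
        fun _ _ _ => by positivity)
    refine Finset.sum_congr rfl fun m _ => ?_
    push_cast
    rw [show (i : ℝ) - (i + m) = -m by ring, abs_neg, abs_of_nonneg (by positivity)]
  rw [← Finset.sum_range_add_sum_Ico _ hi.le]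
  linarith

theorem exists_dilate_kernel_bound {a : ℝ → ℝ} (ha : IsAmplitude a) :
    ∃ C, 0 < C ∧ ∀ (l s : ℝ) (z : E3), 0 < l →
      ‖waveKernel (fun ρ => a (ρ / l)) s z‖ ≤
        C * l ^ 3 / ((1 + l * (|s| + ‖z‖)) * (1 + l * |(|s| - ‖z‖)|) ^ 2) := by
  obtain ⟨C, hC, h⟩ := exists_waveKernel_bound ha
  refine ⟨C, hC, fun l s z hl => ?_⟩
  have h1 := h (l * s) (l • z)
  rw [norm_smul, Real.norm_of_nonneg hl.le, abs_mul, abs_of_pos hl, ← mul_sub, abs_mul,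
    abs_of_pos hl, add_assoc, ← mul_add] at h1
  rw [waveKernel_dilate a hl, norm_mul, norm_pow, Complex.norm_real, Real.norm_of_nonneg hl.le,
    mul_comm C, mul_div_assoc]
  gcongr

/-- Cauchy-Schwarz on `S`: only the part of the kernel seen from the support of the data counts. -/
theorem norm_halfWave_cutLp_sq_le {a : ℝ → ℝ} (ha : IsAmplitude a) {S : Set E3}
    (hS : MeasurableSet S) (s : ℝ) (x : E3) (g : Lp ℂ 2 (volume : Measure E3)) :
    ‖halfWave ha s x (cutLp hS g)‖ₑ ^ 2 ≤
      (∫⁻ y in S, ‖waveKernel a (-s) (y - x)‖ₑ ^ 2) * ‖cutLp hS g‖ₑ ^ 2 := by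
  have hK := (memLp_waveKernel ha (-s) x).aestronglyMeasurable.enorm.restrict (s := S)
  have hg := (Lp.memLp g).aestronglyMeasurable.enorm.restrict (s := S)
  have h1 : ‖halfWave ha s x (cutLp hS g)‖ₑ ≤
      ∫⁻ y in S, ‖(starRingEnd ℂ) (waveKernel a (-s) (y - x))‖ₑ * ‖g y‖ₑ := by
    rw [halfWave_cutLp]
    refine (enorm_integral_le_lintegral_enorm _).trans (le_of_eq ?_)
    simp only [enorm_mul]
  have h2 := ENNReal.lintegral_mul_le_Lp_mul_Lq (volume.restrict S)
    (Real.HolderConjugate.two_two) hK hg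
  have hsq : ∀ X : ℝ≥0∞, (X ^ (1 / 2 : ℝ)) ^ 2 = X := fun X => by
    rw [← ENNReal.rpow_natCast, ← ENNReal.rpow_mul]; norm_num
  have h3 : ‖cutLp hS g‖ₑ ^ 2 = ∫⁻ y in S, ‖g y‖ₑ ^ (2 : ℝ) := by
    rw [enorm_cutLp, eLpNorm_indicator_eq_eLpNorm_restrict hS,
      eLpNorm_eq_lintegral_rpow_enorm_toReal (by norm_num) (by norm_num)]
    simp only [ENNReal.toReal_ofNat]
    rw [hsq]
  have h4 := pow_le_pow_left₀ zero_le (h1.trans h2) 2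
  rw [mul_pow, hsq, hsq] at h4
  rw [h3]
  refine h4.trans (le_of_eq ?_)
  congr 1
  refine lintegral_congr fun y => ?_
  rw [RCLike.enorm_conj]
  exact_mod_cast rfl

theorem lintegral_biUnion_finset_le {α ι : Type*} [MeasurableSpace α] (μ : Measure α)
    (I : Finset ι) (t : ι → Set α) (f : α → ℝ≥0∞) :
    ∫⁻ x in ⋃ i ∈ I, t i, f x ∂μ ≤ ∑ i ∈ I, ∫⁻ x in t i, f x ∂μ := by
  classical
  induction I using Finset.induction_on with
  | empty => simp
  | insert i I hi ih =>
    rw [Finset.set_biUnion_insert, Finset.sum_insert hi]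
    exact (lintegral_union_le _ _ _).trans (by gcongr)

theorem lintegral_Ico_le_sum {f : ℝ → ℝ≥0∞} (hf : Measurable f) {δ : ℝ} (hδ : 0 < δ) (N : ℕ) :
    ∫⁻ s in Set.Ico 0 (N * δ), f s ≤
      ∫⁻ s in Set.Ico 0 δ, ∑ n ∈ Finset.range N, f (s + n * δ) := by
  have hsub : Set.Ico 0 (N * δ) ⊆ ⋃ n ∈ Finset.range N, Set.Ico (n * δ) ((n + 1 : ℝ) * δ) := by
    intro s hs
    have h0 : 0 ≤ s / δ := div_nonneg hs.1 hδ.le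
    refine Set.mem_iUnion₂.2 ⟨⌊s / δ⌋₊, Finset.mem_range.2 ?_, ?_, ?_⟩
    · rw [Nat.floor_lt h0, div_lt_iff₀ hδ]; exact hs.2
    · rw [← le_div_iff₀ hδ]; exact Nat.floor_le h0
    · rw [← div_lt_iff₀ hδ]; exact Nat.lt_floor_add_one _
  calc _ ≤ _ := lintegral_mono_set hsub
    _ ≤ ∑ n ∈ Finset.range N, ∫⁻ s in Set.Ico (n * δ) ((n + 1 : ℝ) * δ), f s :=
        lintegral_biUnion_finset_le _ _ _ _
    _ = ∑ n ∈ Finset.range N, ∫⁻ s in Set.Ico 0 δ, f (s + n * δ) := by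
        refine Finset.sum_congr rfl fun n _ => ?_
        rw [← lintegral_indicator measurableSet_Ico, ← lintegral_indicator measurableSet_Ico,
          ← lintegral_add_right_eq_self _ ((n : ℝ) * δ)]
        congr 1
        ext s
        by_cases h : s ∈ Set.Ico 0 δ
        · rw [Set.indicator_of_mem h, Set.indicator_of_mem]
          exact ⟨by linarith [h.1], by linarith [h.2]⟩
        · rw [Set.indicator_of_notMem h, Set.indicator_of_notMem]
          exact fun h' => h ⟨by linarith [h'.1], by linarith [h'.2]⟩
    _ = _ := (lintegral_finsetSum _ fun n _ => hf.comp (measurable_id.add_const _)).symm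

/-- The endpoint Strichartz estimate on a finite time interval, with a small power loss. -/
theorem exists_endpoint_strichartz {a : ℝ → ℝ} (ha : IsAmplitude a) {ε : ℝ} (hε : 0 < ε) :
    ∃ C, 0 < C ∧ ∀ (l : ℝ) (hl : 0 < l) (T σ : ℝ), 1 ≤ l * T → |σ| = 1 →
      ∀ g : Lp ℂ 2 (volume : Measure E3),
        ∫⁻ s in Set.Ico 0 (2 * T), (⨆ x, ‖halfWave (ha.dilate hl) (σ * s) x g‖ₑ) ^ 2 ≤
          ENNReal.ofReal (C * l ^ 2 * (l * T) ^ ε) * ‖g‖ₑ ^ 2 := by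
  obtain ⟨C, hC, hK⟩ := exists_dilate_kernel_bound ha.sq
  refine ⟨C * (2 * (1 + 1 / ε)) * 3 ^ ε, by positivity, fun l hl T σ hT hσ g => ?_⟩
  -- Times are sampled at spacing `1/l`, the time scale of frequency `l`; `N` samples cover `[0,
  -- 2T)`.
  set N : ℕ := ⌈2 * (l * T)⌉₊ with hN
  set δ : ℝ := 1 / l with hδ
  have hδ0 : 0 < δ := by positivity
  have hNle : (N : ℝ) ≤ 3 * (l * T) := by
    have := Nat.ceil_lt_add_one (show 0 ≤ 2 * (l * T) by linarith)
    linarith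
  have hN1 : (1 : ℝ) ≤ N := by
    have := Nat.le_ceil (2 * (l * T))
    rw [← hN] at this
    linarith
  have hNδ : 2 * T ≤ N * δ := by
    rw [hδ, mul_one_div, le_div_iff₀ hl]
    have := Nat.le_ceil (2 * (l * T))
    rw [← hN] at this
    linarith
  set M : ℝ := C * l ^ 3 * (2 * (1 + Real.log N)) with hM
  have hlog : 0 ≤ Real.log N := Real.log_nonneg hN1
  have hM0 : 0 ≤ M := by positivity
  have hcont : ∀ x, Continuous fun s => halfWave (ha.dilate hl) (σ * s) x g := fun x =>
    (continuous_halfWave_time (ha.dilate hl) x g).comp (continuous_const.mul continuous_id)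
  have hpt : ∀ s : ℝ, ∑ n ∈ Finset.range N,
      (⨆ x, ‖halfWave (ha.dilate hl) (σ * (s + n * δ)) x g‖ₑ) ^ 2 ≤
        ENNReal.ofReal M * ‖g‖ₑ ^ 2 := by
    intro s
    have e : ∀ n : ℕ, (⨆ x, ‖halfWave (ha.dilate hl) (σ * (s + n * δ)) x g‖ₑ) ^ 2 =
        ⨆ x, ‖halfWave (ha.dilate hl) (σ * (s + n * δ)) x g‖ₑ ^ 2 := fun n =>
      ENNReal.iSup_pow _ _
    simp only [e]
    refine sum_iSup_le _ _ fun χ => ?_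
    -- One packet per sampled time, at an arbitrary point `χ n`. The Gram bound uses only the
    -- separation in time, hence is uniform in `χ`.
    have hsel := sum_norm_inner_sq_le (Finset.range N) (fun n : ℕ =>
      (wavePacket (ha.dilate hl) (-(σ * (s + n * δ))) (-(χ n))).toLp 2 (volume : Measure E3))
      (𝓕 g : Lp ℂ 2 (volume : Measure E3)) hM0 (by
        intro i hi
        have hrow := sum_range_dist_le (Finset.mem_range.1 hi)
        rw [hM]
        refine le_trans ?_ (mul_le_mul_of_nonneg_left hrow (by positivity))
        rw [Finset.mul_sum]
        refine Finset.sum_le_sum fun j _ => ?_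
        rw [inner_wavePacket]
        refine (hK l _ _ hl).trans ?_
        rw [mul_one_div (C * l ^ 3)]
        have habs : |(-(σ * (s + j * δ)) - -(σ * (s + i * δ)))| = |(i : ℝ) - j| / l := by
          rw [show -(σ * (s + j * δ)) - -(σ * (s + i * δ)) = σ * ((i : ℝ) - j) * (1 / l) by
            rw [hδ]; ring, abs_mul, abs_mul, hσ, one_mul,
            abs_of_pos (show 0 < 1 / l by positivity), mul_one_div]
        rw [habs]
        gcongr
        refine le_trans ?_ (le_mul_of_one_le_right (by positivity) (one_le_pow₀ (by
          have : 0 ≤ l * |(|(i : ℝ) - j| / l - ‖-χ j - -χ i‖)| := by positivity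
          linarith)))
        rw [mul_add, mul_div_cancel₀ _ hl.ne']
        have : 0 ≤ l * ‖-χ j - -χ i‖ := by positivity
        linarith)
    rw [Lp.norm_fourier_eq] at hsel
    have h2 := ENNReal.ofReal_le_ofReal hsel
    rw [ENNReal.ofReal_mul hM0, ENNReal.ofReal_pow (norm_nonneg _), ofReal_norm,
      ENNReal.ofReal_sum_of_nonneg fun _ _ => by positivity] at h2
    refine le_trans (le_of_eq ?_) h2
    refine Finset.sum_congr rfl fun n _ => ?_
    rw [ENNReal.ofReal_pow (norm_nonneg _), ofReal_norm]
    rfl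
  have hmeas : Measurable fun s => (⨆ x, ‖halfWave (ha.dilate hl) (σ * s) x g‖ₑ) ^ 2 :=
    (measurable_iSup_enorm (v := fun s x => halfWave (ha.dilate hl) (σ * s) x g) hcont).pow_const 2
  -- The factor `1/l` is the length of the interval of starting times. The logarithm of `N` is
  -- absorbed into `(lT)^ε`.
  have hfin : M * δ ≤ C * (2 * (1 + 1 / ε)) * 3 ^ ε * l ^ 2 * (l * T) ^ ε := by
    have h1 : Real.log N ≤ (N : ℝ) ^ ε / ε := Real.log_le_rpow_div (by positivity) hε
    have h2 : (1 : ℝ) ≤ (N : ℝ) ^ ε := Real.one_le_rpow hN1 hε.le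
    have h3 : (N : ℝ) ^ ε ≤ 3 ^ ε * (l * T) ^ ε := by
      rw [← Real.mul_rpow (by norm_num) (by linarith)]
      exact Real.rpow_le_rpow (by positivity) hNle hε.le
    have h4 : 1 + Real.log N ≤ (1 + 1 / ε) * (3 ^ ε * (l * T) ^ ε) := by
      refine le_trans ?_ (mul_le_mul_of_nonneg_left h3 (by positivity))
      rw [add_mul, one_mul, one_div_mul_eq_div]
      linarith
    calc M * δ = C * l ^ 2 * 2 * (1 + Real.log N) := by
          rw [hM, hδ]; field_simp
      _ ≤ C * l ^ 2 * 2 * ((1 + 1 / ε) * (3 ^ ε * (l * T) ^ ε)) := by gcongr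
      _ = _ := by ring
  calc _ ≤ ∫⁻ s in Set.Ico 0 (N * δ), (⨆ x, ‖halfWave (ha.dilate hl) (σ * s) x g‖ₑ) ^ 2 :=
        lintegral_mono_set (Set.Ico_subset_Ico_right hNδ)
    _ ≤ _ := lintegral_Ico_le_sum hmeas hδ0 N
    _ ≤ ∫⁻ _ in Set.Ico 0 δ, ENNReal.ofReal M * ‖g‖ₑ ^ 2 := lintegral_mono hpt
    _ = ENNReal.ofReal (M * δ) * ‖g‖ₑ ^ 2 := by
        rw [setLIntegral_const, Real.volume_Ico, sub_zero, ENNReal.ofReal_mul hM0]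
        ring
    _ ≤ _ := by gcongr

/-- Short times: the trivial bound. -/
theorem exists_shellSup_short {a : ℝ → ℝ} (ha : IsAmplitude a) :
    ∃ C, 0 < C ∧ ∀ (l : ℝ) (hl : 0 < l) (T σ : ℝ), 0 < T →
      ∀ g : Lp ℂ 2 (volume : Measure E3),
        ∫⁻ s in Set.Ici 0, shellSup T (fun s x => halfWave (ha.dilate hl) (σ * s) x g) s ^ 2 ≤
          ENNReal.ofReal (C * l ^ 2 * (l * T)) * ‖g‖ₑ ^ 2 := by
  set K := ‖waveKernel (fun ρ => a ρ ^ 2) 0 0‖ with hK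
  refine ⟨2 * (K + 1), by positivity, fun l hl T σ hT g => ?_⟩
  refine (lintegral_shellSup_sq_le (B := ENNReal.ofReal (l ^ 3 * (K + 1)) * ‖g‖ₑ ^ 2)
    fun s x _ _ => ?_).trans (le_of_eq ?_)
  · have h := norm_halfWave_le (ha.dilate hl) (σ * s) x g
    have h2 : ‖waveKernel (fun ρ => a (ρ / l) ^ 2) 0 0‖ ≤ l ^ 3 * (K + 1) := by
      rw [waveKernel_dilate (fun ρ => a ρ ^ 2) hl, norm_mul, norm_pow, Complex.norm_real,
        Real.norm_of_nonneg hl.le, mul_zero, smul_zero]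
      gcongr
      linarith
    have h3 := ENNReal.ofReal_le_ofReal (h.trans (mul_le_mul_of_nonneg_right h2 (by positivity)))
    rwa [ENNReal.ofReal_mul (by positivity), ENNReal.ofReal_pow (norm_nonneg _), ofReal_norm,
      ENNReal.ofReal_pow (norm_nonneg _), ofReal_norm] at h3
  · rw [mul_right_comm, ← ENNReal.ofReal_mul (by positivity)]
    congr 2
    ring

/-- Short times and data in a small ball. -/
theorem exists_shellSup_short_ball {a : ℝ → ℝ} (ha : IsAmplitude a) :
    ∃ C, 0 < C ∧ ∀ (l : ℝ) (hl : 0 < l) (R T σ : ℝ), 0 < R → 0 < T →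
      ∀ (S : Set E3) (hS : MeasurableSet S), S ⊆ Metric.closedBall 0 R →
      ∀ g : Lp ℂ 2 (volume : Measure E3),
        ∫⁻ s in Set.Ici 0,
            shellSup T (fun s x => halfWave (ha.dilate hl) (σ * s) x (cutLp hS g)) s ^ 2 ≤
          ENNReal.ofReal (C * l ^ 2 * (l * T) * (l * R) ^ 3) * ‖cutLp hS g‖ₑ ^ 2 := by
  obtain ⟨C, hC, hK⟩ := exists_dilate_kernel_bound ha
  refine ⟨2 * C ^ 2 * (Real.pi * 4 / 3), by positivity,
    fun l hl R T σ hR hT S hS hSR g => ?_⟩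
  refine (lintegral_shellSup_sq_le
    (B := ENNReal.ofReal ((C * l ^ 3) ^ 2 * (R ^ 3 * (Real.pi * 4 / 3))) * ‖cutLp hS g‖ₑ ^ 2)
    fun s x _ _ => ?_).trans (le_of_eq ?_)
  · refine (norm_halfWave_cutLp_sq_le (ha.dilate hl) hS (σ * s) x g).trans ?_
    gcongr
    calc _ ≤ ∫⁻ _ in S, ENNReal.ofReal ((C * l ^ 3) ^ 2) := by
          refine lintegral_mono fun y => ?_
          rw [← ofReal_norm, ← ENNReal.ofReal_pow (norm_nonneg _)]
          gcongr
          refine (hK l _ _ hl).trans (div_le_self (by positivity) ?_)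
          refine one_le_mul_of_one_le_of_one_le ?_ (one_le_pow₀ ?_) <;>
            exact le_add_of_nonneg_right (by positivity)
      _ ≤ ∫⁻ _ in Metric.closedBall (0 : E3) R, ENNReal.ofReal ((C * l ^ 3) ^ 2) :=
          lintegral_mono_set hSR
      _ = _ := by
          rw [setLIntegral_const, EuclideanSpace.volume_closedBall_fin_three,
            ← ENNReal.ofReal_pow hR.le, ← ENNReal.ofReal_mul (by positivity),
            ← ENNReal.ofReal_mul (by positivity)]
  · rw [mul_right_comm, ← ENNReal.ofReal_mul (by positivity)]
    congr 2
    ring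

/-- Dispersion of data localised in a ball, at distances much larger than its radius. -/
theorem exists_shellSup_dispersive {a : ℝ → ℝ} (ha : IsAmplitude a) :
    ∃ C, 0 < C ∧ ∀ (l : ℝ) (hl : 0 < l) (R T σ : ℝ), 1 ≤ R → 16 * R < T → |σ| = 1 →
      ∀ (S : Set E3) (hS : MeasurableSet S), S ⊆ Metric.closedBall 0 R →
      ∀ g : Lp ℂ 2 (volume : Measure E3),
        ∫⁻ s in Set.Ici 0,
            shellSup T (fun s x => halfWave (ha.dilate hl) (σ * s) x (cutLp hS g)) s ^ 2 ≤
          ENNReal.ofReal (C * l ^ 2 * ((l * R) ^ 2 / (l * T))) * ‖cutLp hS g‖ₑ ^ 2 := by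
  obtain ⟨C, hC, hK⟩ := exists_dilate_kernel_bound ha
  obtain ⟨C', hC', hsh⟩ := exists_shell_bound
  refine ⟨2 * (C * 4) ^ 2 * C', by positivity, fun l hl R T σ hR hT hσ S hS hSR g => ?_⟩
  have hT0 : 0 < T := by linarith
  refine (lintegral_shellSup_sq_le
    (B := ENNReal.ofReal ((C * 4 * l ^ 2 / T) ^ 2 * (C' * R ^ 2 / l)) * ‖cutLp hS g‖ₑ ^ 2)
    fun s x hs hx => ?_).trans (le_of_eq ?_)
  · refine (norm_halfWave_cutLp_sq_le (ha.dilate hl) hS (σ * s) x g).trans ?_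
    gcongr
    calc _ ≤ ∫⁻ y in S, ENNReal.ofReal ((C * 4 * l ^ 2 / T) ^ 2) *
          ENNReal.ofReal (1 / (1 + l * |s - ‖y - x‖|) ^ 4) := by
          refine setLIntegral_mono' hS fun y hy => ?_
          rw [← ofReal_norm, ← ENNReal.ofReal_pow (norm_nonneg _),
            ← ENNReal.ofReal_mul (by positivity)]
          refine ENNReal.ofReal_le_ofReal ?_
          have hyR : ‖y‖ ≤ R := mem_closedBall_zero_iff.1 (hSR hy)
          have hxy : ‖x‖ - ‖y‖ ≤ ‖y - x‖ := by
            rw [norm_sub_rev]; exact norm_sub_norm_le x y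
          -- Both the `1` in `1 + s + ‖x‖` and `‖y‖` are at most `R < T/16`.
          have hfar : T / 4 ≤ s + ‖y - x‖ := by linarith
          have h := hK l (-(σ * s)) (y - x) hl
          rw [abs_neg, abs_mul, hσ, one_mul, abs_of_nonneg hs] at h
          set D := 1 + l * |s - ‖y - x‖| with hD
          have hD0 : 0 < D := by positivity
          have h2 : C * l ^ 3 / ((1 + l * (s + ‖y - x‖)) * D ^ 2) ≤
              C * 4 * l ^ 2 / T * (1 / D ^ 2) := by
            rw [div_mul_div_comm, mul_one, div_le_div_iff₀ (by positivity) (by positivity)]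
            have : l * T ≤ 4 * (1 + l * (s + ‖y - x‖)) := by nlinarith
            calc C * l ^ 3 * (T * D ^ 2) = C * l ^ 2 * D ^ 2 * (l * T) := by ring
              _ ≤ C * l ^ 2 * D ^ 2 * (4 * (1 + l * (s + ‖y - x‖))) := by gcongr
              _ = _ := by ring
          calc _ ≤ (C * 4 * l ^ 2 / T * (1 / D ^ 2)) ^ 2 :=
                pow_le_pow_left₀ (norm_nonneg _) (h.trans h2) 2
            _ = _ := by field_simp
      _ = ENNReal.ofReal ((C * 4 * l ^ 2 / T) ^ 2) *
          ∫⁻ y in S, ENNReal.ofReal (1 / (1 + l * |s - ‖y - x‖|) ^ 4) :=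
          lintegral_const_mul' _ _ ENNReal.ofReal_ne_top
      _ ≤ ENNReal.ofReal ((C * 4 * l ^ 2 / T) ^ 2) * ENNReal.ofReal (C' * R ^ 2 / l) := by
          gcongr
          exact (lintegral_mono_set hSR).trans (hsh l s R x hl (by linarith))
      _ = _ := by rw [← ENNReal.ofReal_mul (by positivity)]
  · rw [mul_right_comm, ← ENNReal.ofReal_mul (by positivity)]
    congr 2
    field_simp

/-- The `L²_s L^∞_x` bound on a space-time shell for data localised in a ball. -/
theorem exists_shell_strichartz {a : ℝ → ℝ} (ha : IsAmplitude a) {θ κ : ℝ} (hθ0 : 0 < θ)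
    (hθ1 : θ < 1) (hκ : -θ / 2 < κ) (hκ0 : κ < 0) :
    ∃ C, 0 < C ∧ ∀ (l : ℝ) (hl : 0 < l) (R T σ : ℝ), 1 ≤ R → 0 < T → |σ| = 1 →
      ∀ (S : Set E3) (hS : MeasurableSet S), S ⊆ Metric.closedBall 0 R →
      ∀ g : Lp ℂ 2 (volume : Measure E3),
        ∫⁻ s in Set.Ici 0,
            shellSup T (fun s x => halfWave (ha.dilate hl) (σ * s) x (cutLp hS g)) s ^ 2 ≤
          ENNReal.ofReal (C * l ^ 2 * ((l * R) ^ (2 * θ) * (l * T) ^ (2 * κ))) *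
            ‖cutLp hS g‖ₑ ^ 2 := by
  obtain ⟨C₁, hC₁, h1⟩ := exists_shellSup_short ha
  obtain ⟨C₂, hC₂, h2⟩ := exists_shellSup_short_ball ha
  obtain ⟨C₃, hC₃, h3⟩ := exists_shellSup_dispersive ha
  -- The permitted loss `2κ + θ` is positive exactly because `κ > -θ/2`.
  obtain ⟨C₄, hC₄, h4⟩ := exists_endpoint_strichartz ha (ε := 2 * κ + θ) (by linarith)
  refine ⟨C₁ + C₂ + C₃ + 256 * C₄, by positivity, fun l hl R T σ hR hT hσ S hS hSR g => ?_⟩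
  have hA : 0 < l * R := by positivity
  have hB : 0 < l * T := by positivity
  have fin : ∀ C X : ℝ, 0 < C → C ≤ C₁ + C₂ + C₃ + 256 * C₄ → 0 ≤ X →
      X ≤ (l * R) ^ (2 * θ) * (l * T) ^ (2 * κ) →
      ENNReal.ofReal (C * l ^ 2 * X) * ‖cutLp hS g‖ₑ ^ 2 ≤
      ENNReal.ofReal ((C₁ + C₂ + C₃ + 256 * C₄) * l ^ 2 *
        ((l * R) ^ (2 * θ) * (l * T) ^ (2 * κ))) * ‖cutLp hS g‖ₑ ^ 2 := by
    intro C X hC0 hC hX0 hX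
    gcongr
  rcases le_or_gt (l * T) 1 with hT1 | hT1
  · have hb : l * T ≤ (l * T) ^ (2 * κ) := by
      have := Real.rpow_le_rpow_of_exponent_ge hB hT1 (show 2 * κ ≤ 1 by linarith)
      rwa [Real.rpow_one] at this
    rcases le_or_gt 1 (l * R) with hR1 | hR1
    · refine (h1 l hl T σ hT _).trans (fin C₁ _ hC₁ (by linarith) hB.le ?_)
      have : 1 ≤ (l * R) ^ (2 * θ) := Real.one_le_rpow hR1 (by positivity)
      calc l * T ≤ (l * T) ^ (2 * κ) := hb
        _ ≤ _ := le_mul_of_one_le_left (by positivity) this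
    · have := h2 l hl R T σ (by linarith) hT S hS hSR g
      rw [mul_assoc (C₂ * l ^ 2)] at this
      refine this.trans (fin C₂ _ hC₂ (by linarith) (by positivity) ?_)
      have h3 : (l * R) ^ 3 ≤ (l * R) ^ (2 * θ) := by
        rw [← Real.rpow_natCast]
        exact Real.rpow_le_rpow_of_exponent_ge hA hR1.le (by push_cast; linarith)
      rw [mul_comm (l * T)]
      gcongr
  · set y := (l * R) ^ 2 / (l * T) with hy
    have hy0 : 0 < y := by positivity
    have htarget : (l * R) ^ (2 * θ) * (l * T) ^ (2 * κ) = y ^ θ * (l * T) ^ (2 * κ + θ) := by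
      rw [hy, Real.div_rpow (by positivity) hB.le, Real.rpow_add hB, Real.rpow_mul hA.le,
        Real.rpow_ofNat]
      have : (l * T) ^ θ ≠ 0 := by positivity
      field_simp
    have hbe : 1 ≤ (l * T) ^ (2 * κ + θ) := Real.one_le_rpow hT1.le (by linarith)
    -- For `y ≥ 1/256` the endpoint bound suffices, `y^θ` being bounded below. For smaller `y` the
    -- dispersive bound `y ≤ y^θ` is better, and it is available because `T ≤ 16R` would force `256
    -- y ≥ lT > 1`.
    rcases le_or_gt 1 (256 * y) with hy1 | hy1
    · refine le_trans ?_ (fin (256 * C₄) (1 / 256 * (l * T) ^ (2 * κ + θ)) (by positivity)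
        (by linarith) (by positivity) ?_)
      · rw [lintegral_shellSup_sq]
        refine le_trans (lintegral_mono fun s => pow_le_pow_left₀ zero_le
          (shellSup_le_iSup _ _ _) 2) ((h4 l hl T σ hT1.le hσ _).trans (le_of_eq ?_))
        congr 2
        ring
      · rw [htarget]
        gcongr
        calc (1 / 256 : ℝ) = (1 / 256) ^ (1 : ℝ) := by rw [Real.rpow_one]
          _ ≤ (1 / 256) ^ θ :=
            Real.rpow_le_rpow_of_exponent_ge (by norm_num) (by norm_num) hθ1.le
          _ ≤ y ^ θ := Real.rpow_le_rpow (by norm_num) (by linarith) hθ0.le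
    · have hRT : 16 * R < T := by
        by_contra hc
        have hc : T ≤ 16 * R := not_lt.1 hc
        have h5 : l * T ≤ 16 * (l * R) := by nlinarith
        have : l * T ≤ 256 * y := by
          rw [hy, ← mul_div_assoc, le_div_iff₀ hB]
          nlinarith
        linarith
      refine (h3 l hl R T σ hR hRT hσ S hS hSR g).trans
        (fin C₃ _ hC₃ (by linarith) hy0.le ?_)
      rw [htarget]
      calc y = y ^ (1 : ℝ) := by rw [Real.rpow_one]
        _ ≤ y ^ θ := Real.rpow_le_rpow_of_exponent_ge hy0 (by linarith) hθ1.le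
        _ ≤ _ := le_mul_of_one_le_right (by positivity) hbe

/-! ### Minkowski's inequality for series and interpolation -/

theorem enorm_le_tsum_of_hasSum {f : ℕ → ℂ} {z : ℂ}
    (h : Filter.Tendsto (fun N => ∑ n ∈ Finset.range N, f n) Filter.atTop (nhds z)) :
    ‖z‖ₑ ≤ ∑' n, ‖f n‖ₑ :=
  le_of_tendsto ((continuous_enorm.tendsto z).comp h) (Filter.Eventually.of_forall fun _ =>
    (enorm_sum_le _ _).trans (ENNReal.sum_le_tsum _))

theorem lintegral_Lp_finsetSum_le {α ι : Type*} [MeasurableSpace α] (μ : Measure α)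
    {f : ι → α → ℝ≥0∞} (hf : ∀ i, AEMeasurable (f i) μ) {q : ℝ} (hq : 1 ≤ q) (I : Finset ι) :
    (∫⁻ x, (∑ i ∈ I, f i x) ^ q ∂μ) ^ (1 / q) ≤ ∑ i ∈ I, (∫⁻ x, f i x ^ q ∂μ) ^ (1 / q) := by
  classical
  have hq0 : 0 < q := by linarith
  induction I using Finset.induction_on with
  | empty => simp [hq0]
  | insert i I hi ih =>
    simp only [Finset.sum_insert hi]
    have := ENNReal.lintegral_Lp_add_le (hf i) (Finset.aemeasurable_fun_sum I fun j _ => hf j) hq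
    exact this.trans (by gcongr)

/-- Minkowski's inequality for countable sums. -/
theorem lintegral_Lp_tsum_le {α ι : Type*} [MeasurableSpace α] [Countable ι] (μ : Measure α)
    {f : ι → α → ℝ≥0∞} (hf : ∀ i, AEMeasurable (f i) μ) {q : ℝ} (hq : 1 ≤ q) :
    (∫⁻ x, (∑' i, f i x) ^ q ∂μ) ^ (1 / q) ≤ ∑' i, (∫⁻ x, f i x ^ q ∂μ) ^ (1 / q) := by
  classical
  have hq0 : 0 < q := by linarith
  have h1 : ∀ x, (∑' i, f i x) ^ q = ⨆ I : Finset ι, (∑ i ∈ I, f i x) ^ q := by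
    intro x
    rw [ENNReal.tsum_eq_iSup_sum]
    exact (ENNReal.orderIsoRpow q hq0).map_iSup _
  simp only [h1]
  rw [lintegral_iSup_directed (fun I => (Finset.aemeasurable_fun_sum I fun j _ => hf j).pow_const q)]
  · have h2 : (⨆ I : Finset ι, ∫⁻ x, (∑ i ∈ I, f i x) ^ q ∂μ) ^ (1 / q) =
        ⨆ I : Finset ι, (∫⁻ x, (∑ i ∈ I, f i x) ^ q ∂μ) ^ (1 / q) :=
      (ENNReal.orderIsoRpow (1 / q) (by positivity)).map_iSup _
    rw [h2]
    exact iSup_le fun I => (lintegral_Lp_finsetSum_le μ hf hq I).trans (ENNReal.sum_le_tsum I)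
  · refine Monotone.directed_le fun I J hIJ x => ?_
    exact ENNReal.rpow_le_rpow (Finset.sum_le_sum_of_subset hIJ) hq0.le

theorem eLpNorm_le_tsum {α ι F : Type*} [MeasurableSpace α] [Countable ι] [NormedAddCommGroup F]
    (μ : Measure α) {u : α → F} {v : ι → α → F} (hv : ∀ i, AEStronglyMeasurable (v i) μ)
    (h : ∀ x, ‖u x‖ₑ ≤ ∑' i, ‖v i x‖ₑ) {r : ℝ≥0∞} (hr : 1 ≤ r) :
    eLpNorm u r μ ≤ ∑' i, eLpNorm (v i) r μ := by
  have hr0 : r ≠ 0 := (zero_lt_one.trans_le hr).ne'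
  by_cases hrt : r = ⊤
  · subst hrt
    simp only [eLpNorm_exponent_top]
    refine essSup_le_of_ae_le _ ?_
    have hall : ∀ᵐ x ∂μ, ∀ i, ‖v i x‖ₑ ≤ eLpNormEssSup (v i) μ :=
      ae_all_iff.2 fun i => enorm_ae_le_eLpNormEssSup (v i) μ
    filter_upwards [hall] with x hx
    exact (h x).trans (ENNReal.tsum_le_tsum hx)
  · simp only [eLpNorm_eq_lintegral_rpow_enorm_toReal hr0 hrt]
    have hr1 : 1 ≤ r.toReal := by
      rw [← ENNReal.toReal_one]
      exact ENNReal.toReal_mono hrt hr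
    refine le_trans ?_ (lintegral_Lp_tsum_le μ (fun i => (hv i).enorm) hr1)
    gcongr with x
    exact h x

/-- Interpolation between `L²` and `L^∞` along the line `1/p + 1/r = 1/2`. -/
theorem eLpNorm_le_rpow_mul_rpow {α F : Type*} [MeasurableSpace α] [NormedAddCommGroup F]
    {μ : Measure α} {u : α → F} (hu : AEStronglyMeasurable u μ) {X D : ℝ≥0∞}
    (hX : ∀ x, ‖u x‖ₑ ≤ X) (hD : eLpNorm u 2 μ ≤ D) {p : ℝ} {r : ℝ≥0∞} (hp : 2 ≤ p)
    (hpr : (ENNReal.ofReal p)⁻¹ + r⁻¹ = 2⁻¹) :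
    eLpNorm u r μ ≤ X ^ (2 / p) * D ^ (1 - 2 / p) := by
  have hp0 : 0 < p := by linarith
  by_cases hrt : r = ⊤
  · have hp2 : p = 2 := by
      rw [hrt, ENNReal.inv_top, add_zero, inv_inj] at hpr
      have := congrArg ENNReal.toReal hpr
      rwa [ENNReal.toReal_ofReal hp0.le, ENNReal.toReal_ofNat] at this
    rw [hrt, hp2, eLpNorm_exponent_top]
    norm_num
    exact essSup_le_of_ae_le _ (Filter.Eventually.of_forall hX)
  · have hr0 : r ≠ 0 := by
      rintro rfl
      rw [ENNReal.inv_zero, add_top] at hpr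
      exact absurd hpr.symm (by norm_num)
    have hrr : 0 < r.toReal := ENNReal.toReal_pos hr0 hrt
    have hreal : p⁻¹ + r.toReal⁻¹ = 2⁻¹ := by
      have := congrArg ENNReal.toReal hpr
      rwa [ENNReal.toReal_add (by simp [hp0]) (by simp [hr0]), ENNReal.toReal_inv,
        ENNReal.toReal_inv, ENNReal.toReal_inv, ENNReal.toReal_ofReal hp0.le,
        ENNReal.toReal_ofNat] at this
    set q := r.toReal with hq
    have hqe1 : (q - 2) / q = 2 / p := by
      have : (q - 2) / q = 1 - 2 * q⁻¹ := by field_simp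
      rw [this, div_eq_mul_inv 2 p]; linarith
    have hqe2 : 2 / q = 1 - 2 / p := by
      rw [div_eq_mul_inv, div_eq_mul_inv]; linarith
    have hq2 : 2 ≤ q := by
      have : 0 ≤ (q - 2) / q := by rw [hqe1]; positivity
      by_contra hc
      exact absurd this (not_le.2 (div_neg_of_neg_of_pos (by linarith) hrr))
    rw [eLpNorm_eq_lintegral_rpow_enorm_toReal hr0 hrt, ← hq]
    have hD2 : ∫⁻ x, ‖u x‖ₑ ^ (2 : ℝ) ∂μ ≤ D ^ (2 : ℝ) := by
      rw [eLpNorm_eq_lintegral_rpow_enorm_toReal (by norm_num) (by norm_num),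
        ENNReal.toReal_ofNat] at hD
      have := ENNReal.rpow_le_rpow hD (show (0 : ℝ) ≤ 2 by norm_num)
      rwa [← ENNReal.rpow_mul, one_div_mul_cancel (by norm_num), ENNReal.rpow_one] at this
    calc (∫⁻ x, ‖u x‖ₑ ^ q ∂μ) ^ (1 / q)
        ≤ (X ^ (q - 2) * D ^ (2 : ℝ)) ^ (1 / q) := by
          gcongr
          -- All but two powers of `u` are bounded by the supremum; since `1/p + 1/q = 1/2`, the
          -- exponent `(q - 2)/q` equals `2/p`.
          calc ∫⁻ x, ‖u x‖ₑ ^ q ∂μ ≤ ∫⁻ x, X ^ (q - 2) * ‖u x‖ₑ ^ (2 : ℝ) ∂μ := by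
                refine lintegral_mono fun x => ?_
                calc ‖u x‖ₑ ^ q = ‖u x‖ₑ ^ (q - 2) * ‖u x‖ₑ ^ (2 : ℝ) := by
                      rw [← ENNReal.rpow_add_of_nonneg _ _ (by linarith) (by norm_num)]
                      congr 1
                      ring
                  _ ≤ _ := by gcongr; exact hX x
            _ = X ^ (q - 2) * ∫⁻ x, ‖u x‖ₑ ^ (2 : ℝ) ∂μ :=
                lintegral_const_mul'' _ (hu.enorm.pow_const _)
            _ ≤ _ := by gcongr
      _ = X ^ (2 / p) * D ^ (1 - 2 / p) := by
          rw [ENNReal.mul_rpow_of_nonneg _ _ (by positivity), ← ENNReal.rpow_mul,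
            ← ENNReal.rpow_mul, mul_one_div, mul_one_div, hqe1, hqe2]

/-! ### Frequency decomposition of the evolution -/

/-- The amplitude of one dyadic piece of `|∇|^{-ι}`, as a function of Mathlib's frequency. -/
def waveAmplitude (ψ : ℝ → ℝ) (ι : ℕ) (ρ : ℝ) : ℝ :=
  if ρ ≤ 0 then 0
  else (ψ (2 * Real.pi * ρ) - ψ (2 * (2 * Real.pi * ρ))) * ((2 * Real.pi * ρ)⁻¹) ^ ι

theorem IsCutoff.waveAmplitude_eq_zero_of_lt {ψ : ℝ → ℝ} (hψ : IsCutoff ψ) (ι : ℕ) {ρ : ℝ}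
    (h : ρ < 5 / (16 * Real.pi)) : waveAmplitude ψ ι ρ = 0 := by
  rw [waveAmplitude]
  split_ifs with h0
  · rfl
  · have hpi := Real.pi_pos
    have h1 : 0 < 2 * Real.pi * ρ := mul_pos (by positivity) (not_le.1 h0)
    rw [lt_div_iff₀ (by positivity)] at h
    rw [hψ.eq_one _ ⟨by linarith, by linarith⟩, hψ.eq_one _ ⟨by linarith, by linarith⟩, sub_self,
      zero_mul]

theorem IsCutoff.isAmplitude {ψ : ℝ → ℝ} (hψ : IsCutoff ψ) (ι : ℕ) :
    IsAmplitude (waveAmplitude ψ ι) := by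
  have hpi := Real.pi_pos
  -- Below `5/(16π)` both cutoffs equal `1` and cancel. Above `1` both vanish, since `2π > 8/5`.
  refine ⟨?_, 5 / (16 * Real.pi), 1, by positivity, ?_, ?_⟩
  · rw [contDiff_iff_contDiffAt]
    intro x
    rcases lt_or_ge x (5 / (16 * Real.pi)) with hx | hx
    · refine contDiffAt_const (c := (0 : ℝ)).congr_of_eventuallyEq ?_
      filter_upwards [Iio_mem_nhds hx] with ρ hρ
      exact hψ.waveAmplitude_eq_zero_of_lt ι hρ
    · have hx0 : 0 < x := lt_of_lt_of_le (by positivity) hx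
      have h1 : ContDiffAt ℝ ∞ (fun ρ : ℝ => (ψ (2 * Real.pi * ρ) - ψ (2 * (2 * Real.pi * ρ))) *
          ((2 * Real.pi * ρ)⁻¹) ^ ι) x := by
        have hs := hψ.smooth
        refine ContDiffAt.mul (ContDiff.contDiffAt ?_) (ContDiffAt.pow (ContDiffAt.inv ?_ ?_) _)
        · exact (hs.comp (contDiff_const.mul contDiff_id)).sub
            (hs.comp (contDiff_const.mul (contDiff_const.mul contDiff_id)))
        · exact (contDiff_const.mul contDiff_id).contDiffAt
        · positivity
      refine h1.congr_of_eventuallyEq ?_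
      filter_upwards [Ioi_mem_nhds hx0] with ρ hρ
      rw [waveAmplitude, if_neg (not_le.2 hρ)]
  · rw [div_lt_one (by positivity)]
    linarith [Real.pi_gt_three]
  · intro ρ hρ
    rcases lt_or_ge ρ (5 / (16 * Real.pi)) with h | h
    · exact hψ.waveAmplitude_eq_zero_of_lt ι h
    · have h1 : 1 < ρ := not_le.1 fun h' => hρ ⟨h, h'⟩
      have h2 : 6 < 2 * Real.pi * ρ := by nlinarith [Real.pi_gt_three]
      rw [waveAmplitude, if_neg (by linarith), hψ.eq_zero _ fun h' => by linarith [h'.2],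
        hψ.eq_zero _ fun h' => by linarith [h'.2]]
      simp

/-- The amplitude contains `|ξ/l|^(-ι)` rather than `|ξ|^(-ι)`; the prefactor `l^(-ι)` restores the
homogeneity. -/
theorem IsCutoff.packet_eq_symbol {ψ : ℝ → ℝ} (ι : ℕ) {l : ℝ} (hl : 0 < l)
    (σ s : ℝ) (x η : E3) :
    (((l⁻¹) ^ ι : ℝ) : ℂ) * wavePacketFun (fun ρ => waveAmplitude ψ ι (ρ / l)) (σ * s) x η =
      wavePhase 0 x η * waveSymbol ι σ s ((2 * Real.pi) • η) *
        ((ψ (2 * Real.pi * ‖η‖ / l) - ψ (2 * (2 * Real.pi * ‖η‖ / l)) : ℝ) : ℂ) := by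
  have hpi := Real.pi_pos
  have hn : ‖(2 * Real.pi) • η‖ = 2 * Real.pi * ‖η‖ := by
    rw [norm_smul, Real.norm_of_nonneg (by positivity)]
  have hphase : wavePhase (σ * s) x η =
      wavePhase 0 x η * Complex.exp (Complex.I * ((σ * s * (2 * Real.pi * ‖η‖) : ℝ) : ℂ)) := by
    rw [wavePhase, wavePhase, ← Complex.exp_add]
    congr 1
    push_cast
    ring
  rw [wavePacketFun, waveSymbol, hn, hphase]
  by_cases h0 : η = 0
  · subst h0
    simp [waveAmplitude]
  · have hη : 0 < ‖η‖ := norm_pos_iff.2 h0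
    have hamp : (l⁻¹) ^ ι * waveAmplitude ψ ι (‖η‖ / l) = ((2 * Real.pi * ‖η‖)⁻¹) ^ ι *
        (ψ (2 * Real.pi * ‖η‖ / l) - ψ (2 * (2 * Real.pi * ‖η‖ / l))) := by
      rw [waveAmplitude, if_neg (not_le.2 (by positivity)), mul_div_assoc, mul_left_comm, ← mul_pow,
        mul_comm]
      congr 2
      field_simp
    have hC := congrArg (fun z : ℝ => (z : ℂ)) hamp
    simp only [Complex.ofReal_mul] at hC
    calc _ = wavePhase 0 x η * Complex.exp (Complex.I * ((σ * s * (2 * Real.pi * ‖η‖) : ℝ) : ℂ)) *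
          ((((l⁻¹) ^ ι : ℝ) : ℂ) * (waveAmplitude ψ ι (‖η‖ / l) : ℂ)) := by ring
      _ = _ := by rw [hC]; ring

/-- The Fourier transform of `P_k f` is unchanged by a slightly wider frequency cutoff. -/
theorem IsCutoff.fourier_lpProj_ae {ψ : ℝ → ℝ} (hψ : IsCutoff ψ) {k : ℤ} (f : 𝓢'(E3, ℂ))
    (g : Lp ℂ 2 (volume : Measure E3)) (hg : Lp.toTemperedDistribution g = lpProj ψ k f) :
    ∀ᵐ η : E3, (𝓕 g : Lp ℂ 2 (volume : Measure E3)) η =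
      (ψ (2 * Real.pi * ‖η‖ / 2 ^ (k + 1)) : ℂ) * (𝓕 g : Lp ℂ 2 (volume : Measure E3)) η := by
  have hpi := Real.pi_pos
  set c : ℝ := 2 * Real.pi / 2 ^ (k + 1) with hc
  have hc0 : 0 < c := by positivity
  have hcη : ∀ η : E3, 2 * Real.pi * ‖η‖ / 2 ^ (k + 1) = c * ‖η‖ := fun η => by rw [hc]; ring
  set m : E3 → ℂ := fun η => (ψ (c * ‖η‖) : ℂ) with hm
  have hmg : m.HasTemperateGrowth :=
    Function.HasTemperateGrowth.comp Function.Complex.hasTemperateGrowth_ofReal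
      ((hψ.hasCompactSupport_comp_norm hc0).hasTemperateGrowth (hψ.contDiff_comp_norm hc0))
  have hmL : MemLp m ⊤ volume := by
    refine memLp_top_of_bound ?_ 1 (Filter.Eventually.of_forall fun η => ?_)
    · have := (hψ.contDiff_comp_norm hc0).continuous
      exact (Complex.continuous_ofReal.comp this).aestronglyMeasurable
    · rw [hm, Complex.norm_real, Real.norm_of_nonneg (hψ.mem_Icc _).1]
      exact (hψ.mem_Icc _).2
  -- The wider cutoff equals `1` on the support of `ψ_k`, because `8/5 · 2^k ≤ 5/4 · 2^(k+1)`.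
  have hprod : (fun η : E3 => (dyadic ψ k ((2 * Real.pi) • η) : ℂ)) * m =
      fun η : E3 => (dyadic ψ k ((2 * Real.pi) • η) : ℂ) := by
    ext η
    simp only [Pi.mul_apply, hm]
    by_cases hle : 2 * Real.pi * ‖η‖ / 2 ^ (k + 1) ≤ 5 / 4
    · rw [← hcη, hψ.eq_one _ ⟨?_, hle⟩]
      · simp
      · have : 0 ≤ 2 * Real.pi * ‖η‖ / 2 ^ (k + 1) := by positivity
        linarith
    · have hgt := not_le.1 hle
      have hn : ‖(2 * Real.pi) • η‖ = 2 * Real.pi * ‖η‖ := by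
        rw [norm_smul, Real.norm_of_nonneg (by positivity)]
      have hzero : dyadic ψ k ((2 * Real.pi) • η) = 0 := by
        have h2k : (2 : ℝ) ^ (k + 1) = 2 ^ k * 2 := zpow_add_one₀ two_ne_zero k
        have h2k' : (2 : ℝ) ^ (k - 1) = 2 ^ k / 2 := by
          rw [zpow_sub_one₀ two_ne_zero]; ring
        have hk0 : (0 : ℝ) < 2 ^ k := by positivity
        rw [lt_div_iff₀ (by positivity), h2k] at hgt
        rw [dyadic, hn]
        split_ifs with hk
        · subst hk
          refine hψ.eq_zero _ fun h => ?_
          have := h.2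
          norm_num at hgt
          linarith
        · rw [hψ.eq_zero, hψ.eq_zero, sub_zero]
          · intro h
            have := h.2
            rw [div_le_iff₀ (by positivity), h2k'] at this
            linarith
          · intro h
            have := h.2
            rw [div_le_iff₀ (by positivity)] at this
            linarith
      rw [hzero]
      simp
  have h1 : TemperedDistribution.fourierMultiplierCLM ℂ m (Lp.toTemperedDistribution g) =
      Lp.toTemperedDistribution g := by
    rw [hg, lpProj, TemperedDistribution.fourierMultiplierCLM_fourierMultiplierCLM_apply
      (hψ.hasTemperateGrowth_dyadic k) hmg, hprod]
  rw [TemperedDistribution.fourierMultiplierCLM_apply] at h1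
  have h2 := congrArg (fun T : 𝓢'(E3, ℂ) => 𝓕 T) h1
  simp only [FourierTransform.fourier_fourierInv_eq, Lp.fourier_toTemperedDistribution_eq] at h2
  set G : Lp ℂ 2 (volume : Measure E3) := 𝓕 g with hG
  have h3 : (Lp.toTemperedDistribution (hmL.toLp m • G : Lp ℂ 2 (volume : Measure E3)) :
      𝓢'(E3, ℂ)) = Lp.toTemperedDistribution G :=
    (Lp.toTemperedDistribution_smul_eq (p := ⊤) (q := 2) (r := 2) hmg hmL G).trans h2
  -- The identity is known only between tempered distributions; injectivity of the embedding of `L²`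
  -- makes it an almost everywhere identity.
  have hinj := LinearMap.ker_eq_bot.1 (Lp.ker_toTemperedDistributionCLM_eq_bot (F := ℂ)
    (μ := (volume : Measure E3)) (p := 2))
  have h4 : (hmL.toLp m • G : Lp ℂ 2 (volume : Measure E3)) = G := hinj h3
  have h5 := Lp.coeFn_lpSMul (r := 2) (hmL.toLp m) G
  rw [h4] at h5
  filter_upwards [h5, hmL.coeFn_toLp] with η e1 e2
  refine e1.trans ?_
  rw [Pi.smul_apply', e2, smul_eq_mul, hcη]

theorem measurable_waveSymbol (ι : ℕ) (σ s : ℝ) : Measurable (waveSymbol ι σ s) := by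
  unfold waveSymbol
  fun_prop

/-- In polar coordinates the volume factor `ρ²` absorbs `|ξ|^(-2ι)`, which is where `ι ≤ 1` enters.
Paired with the `L²` function `𝓕 g`, this makes the inversion integral converge. -/
theorem IsCutoff.memLp_waveSymbol_mul {ψ : ℝ → ℝ} (hψ : IsCutoff ψ) {ι : ℕ} (hι : ι ≤ 1)
    (σ s : ℝ) {L : ℝ} (hL : 0 < L) :
    MemLp (fun η : E3 => waveSymbol ι σ s ((2 * Real.pi) • η) *
      (ψ (2 * Real.pi * ‖η‖ / L) : ℂ)) 2 volume := by
  have hpi := Real.pi_pos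
  have hψc := hψ.smooth.continuous
  have hmeas : AEStronglyMeasurable (fun η : E3 => waveSymbol ι σ s ((2 * Real.pi) • η) *
      (ψ (2 * Real.pi * ‖η‖ / L) : ℂ)) volume := by
    refine Measurable.aestronglyMeasurable ?_
    have h1 := (measurable_waveSymbol ι σ s).comp (measurable_const_smul (α := E3) (2 * Real.pi))
    have h2 : Measurable fun η : E3 => (ψ (2 * Real.pi * ‖η‖ / L) : ℂ) := by fun_prop
    exact h1.mul h2
  rw [memLp_two_iff_integrable_sq_norm hmeas]
  have hnorm : ∀ η : E3, ‖waveSymbol ι σ s ((2 * Real.pi) • η) *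
      (ψ (2 * Real.pi * ‖η‖ / L) : ℂ)‖ ^ 2 =
      (fun y : ℝ => (((2 * Real.pi * y)⁻¹) ^ ι * ψ (2 * Real.pi * y / L)) ^ 2) ‖η‖ := by
    intro η
    rw [waveSymbol, norm_mul, norm_mul, mul_comm Complex.I, Complex.norm_exp_ofReal_mul_I, mul_one,
      Complex.norm_real, Complex.norm_real, ← norm_mul, Real.norm_eq_abs, sq_abs, norm_smul,
      Real.norm_of_nonneg (show 0 ≤ 2 * Real.pi by positivity)]
  simp only [hnorm]
  rw [integrable_fun_norm_addHaar (volume : Measure E3)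
    (f := fun y : ℝ => (((2 * Real.pi * y)⁻¹) ^ ι * ψ (2 * Real.pi * y / L)) ^ 2)]
  simp only [finrank_euclideanSpace, Fintype.card_fin, smul_eq_mul]
  have hcont : Continuous fun y : ℝ =>
      (y ^ (1 - ι) * ((2 * Real.pi)⁻¹) ^ ι * ψ (2 * Real.pi * y / L)) ^ 2 := by fun_prop
  have hcs : HasCompactSupport fun y : ℝ =>
      (y ^ (1 - ι) * ((2 * Real.pi)⁻¹) ^ ι * ψ (2 * Real.pi * y / L)) ^ 2 := by
    refine HasCompactSupport.intro (isCompact_closedBall (0 : ℝ) (8 / 5 * L)) fun y hy => ?_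
    rw [hψ.eq_zero]
    · simp
    · intro h
      refine hy (mem_closedBall_zero_iff.2 ?_)
      rw [Set.mem_Icc, le_div_iff₀ hL, div_le_iff₀ hL] at h
      rw [Real.norm_eq_abs]
      have h1 : |2 * Real.pi * y| ≤ 8 / 5 * L := abs_le.2 ⟨by linarith [h.1], h.2⟩
      rw [abs_mul, abs_of_pos (by positivity : 0 < 2 * Real.pi)] at h1
      nlinarith [Real.pi_gt_three, abs_nonneg y]
  refine (hcont.integrable_of_hasCompactSupport hcs).integrableOn.congr_fun (fun y hy => ?_)
    measurableSet_Ioi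
  have hy : 0 < y := hy
  interval_cases ι
  · simp; ring
  · simp
    field_simp

theorem IsCutoff.integrable_waveFreq {ψ : ℝ → ℝ} (hψ : IsCutoff ψ) {ι : ℕ} (hι : ι ≤ 1) {k : ℤ}
    (f : 𝓢'(E3, ℂ)) (g : Lp ℂ 2 (volume : Measure E3))
    (hg : Lp.toTemperedDistribution g = lpProj ψ k f) (σ s : ℝ) :
    Integrable (waveFreq ι σ s g) := by
  have h := MemLp.integrable_mul (hψ.memLp_waveSymbol_mul hι σ s
    (show (0 : ℝ) < 2 ^ (k + 1) by positivity))
    (Lp.memLp (𝓕 g : Lp ℂ 2 (volume : Measure E3)))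
  refine h.congr ?_
  filter_upwards [hψ.fourier_lpProj_ae f g hg] with η hη
  rw [Pi.mul_apply, waveFreq, mul_assoc, ← hη]

/-- Dyadic decomposition in frequency of the half-wave evolution of `P_k f`. -/
theorem IsCutoff.tendsto_sum_halfWave {ψ : ℝ → ℝ} (hψ : IsCutoff ψ) {ι : ℕ} (hι : ι ≤ 1) {k : ℤ}
    (f : 𝓢'(E3, ℂ)) (g : Lp ℂ 2 (volume : Measure E3))
    (hg : Lp.toTemperedDistribution g = lpProj ψ k f) (σ s : ℝ) (x : E3) {l : ℕ → ℝ}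
    (hl : ∀ n, 0 < l n) (hl2 : ∀ n, l n = 2 ^ (k + 1) / 2 ^ n) :
    Filter.Tendsto (fun N => ∑ n ∈ Finset.range N, ((((l n)⁻¹) ^ ι : ℝ) : ℂ) *
      halfWave ((hψ.isAmplitude ι).dilate (hl n)) (σ * s) x g) Filter.atTop
      (nhds (wave ι σ s g x)) := by
  have hpi := Real.pi_pos
  set G : Lp ℂ 2 (volume : Measure E3) := 𝓕 g with hG
  set y : E3 → ℝ := fun η => 2 * Real.pi * ‖η‖ / 2 ^ (k + 1) with hy
  have hyl : ∀ n η, 2 * Real.pi * ‖η‖ / l n = 2 ^ n * y η := fun n η => by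
    rw [hl2, hy]; field_simp
  have hintegrable := hψ.integrable_waveFreq hι f g hg σ s
  have hsum : ∀ N, ∑ n ∈ Finset.range N, ((((l n)⁻¹) ^ ι : ℝ) : ℂ) *
      halfWave ((hψ.isAmplitude ι).dilate (hl n)) (σ * s) x g =
      ∫ η, wavePhase 0 x η * waveFreq ι σ s g η * ((ψ (y η) - ψ (2 ^ N * y η) : ℝ) : ℂ) := by
    intro N
    simp only [halfWave_eq_integral, ← integral_const_mul]
    rw [← integral_finsetSum]
    · congr 1
      ext η
      -- The dyadic pieces telescope: the first `N` of them add up to the cutoff `ψ(y) - ψ(2^N y)`,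
      -- whose second term vanishes eventually at every `η ≠ 0`.
      have hstep : ∀ n ∈ Finset.range N, ((((l n)⁻¹) ^ ι : ℝ) : ℂ) *
          (wavePacketFun (fun ρ => waveAmplitude ψ ι (ρ / l n)) (σ * s) x η * G η) =
          wavePhase 0 x η * waveFreq ι σ s g η *
            ((ψ (2 ^ n * y η) : ℂ) - (ψ (2 ^ (n + 1) * y η) : ℂ)) := by
        intro n _
        rw [← mul_assoc, IsCutoff.packet_eq_symbol ι (hl n), hyl, waveFreq, ← hG,
          show 2 * (2 ^ n * y η) = 2 ^ (n + 1) * y η by ring]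
        push_cast
        ring
      rw [Finset.sum_congr rfl hstep, ← Finset.mul_sum,
        Finset.sum_range_sub' (fun n => (ψ (2 ^ n * y η) : ℂ))]
      simp
    · intro n _
      exact (integrable_packet_mul ((hψ.isAmplitude ι).dilate (hl n)) _ _ _).const_mul _
  simp only [hsum]
  have hwave : wave ι σ s g x = ∫ η, wavePhase 0 x η * waveFreq ι σ s g η * (ψ (y η) : ℂ) := by
    rw [wave, Real.fourierInv_eq']
    refine integral_congr_ae ?_
    filter_upwards [hψ.fourier_lpProj_ae f g hg] with η hη
    have hη' : waveFreq ι σ s g η * (ψ (y η) : ℂ) = waveFreq ι σ s g η := by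
      rw [waveFreq, mul_assoc, mul_comm _ (ψ (y η) : ℂ), ← hη]
    have hph : Complex.exp (((2 * Real.pi * inner ℝ η x : ℝ) : ℂ) * Complex.I) =
        wavePhase 0 x η := by
      rw [wavePhase, real_inner_comm]
      congr 1
      push_cast
      ring
    rw [mul_assoc (wavePhase 0 x η), hη', hph, smul_eq_mul]
  rw [hwave]
  have hψm : Measurable ψ := hψ.smooth.continuous.measurable
  have hym : Measurable y := by rw [hy]; fun_prop
  refine tendsto_integral_of_dominated_convergence (fun η => ‖waveFreq ι σ s g η‖) (fun N => ?_)
    hintegrable.norm (fun N => Filter.Eventually.of_forall fun η => ?_) ?_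
  · refine ((continuous_wavePhase 0 x).aestronglyMeasurable.mul
      hintegrable.aestronglyMeasurable).mul (Measurable.aestronglyMeasurable ?_)
    fun_prop
  · rw [norm_mul, norm_mul, norm_wavePhase, one_mul, Complex.norm_real]
    refine mul_le_of_le_one_right (norm_nonneg _) ?_
    have h1 := hψ.mem_Icc (y η)
    have h2 := hψ.mem_Icc (2 ^ N * y η)
    rw [Real.norm_eq_abs, abs_le]
    constructor <;> linarith [h1.1, h1.2, h2.1, h2.2]
  · have hne : ∀ᵐ η : E3, η ≠ 0 := by
      simp [ae_iff, measure_singleton]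
    filter_upwards [hne] with η hη
    have hyη : 0 < y η := by
      have := norm_pos_iff.2 hη
      rw [hy]; positivity
    refine tendsto_const_nhds.congr' ?_
    have hlim : Filter.Tendsto (fun N : ℕ => (2 : ℝ) ^ N * y η) Filter.atTop Filter.atTop :=
      (tendsto_pow_atTop_atTop_of_one_lt one_lt_two).atTop_mul_const hyη
    filter_upwards [hlim.eventually_gt_atTop (8 / 5)] with N hN
    rw [hψ.eq_zero (2 ^ N * y η) fun h => by linarith [h.2], sub_zero]

/-! ### Position decomposition and summation of all pieces -/

/-- The dyadic shells `2^j ≤ ⟨y⟩ < 2^(j+1)`. -/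
def bracketShell (j : ℕ) : Set E3 :=
  japaneseBracket ⁻¹' Set.Ico (2 ^ j) (2 ^ (j + 1))

theorem continuous_japaneseBracket : Continuous japaneseBracket := by
  unfold japaneseBracket; fun_prop

theorem one_le_japaneseBracket (x : E3) : 1 ≤ japaneseBracket x :=
  Real.one_le_sqrt.2 (by nlinarith [sq_nonneg ‖x‖])

theorem measurableSet_bracketShell (j : ℕ) : MeasurableSet (bracketShell j) :=
  continuous_japaneseBracket.measurable measurableSet_Ico

theorem pairwise_disjoint_bracketShell : Pairwise (Function.onFun Disjoint bracketShell) := by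
  intro i j hij
  refine Disjoint.preimage _ ?_
  rw [Set.disjoint_left]
  intro z hi hj
  have h1 := (pow_lt_pow_iff_right₀ (one_lt_two (α := ℝ))).1 (hi.1.trans_lt hj.2)
  have h2 := (pow_lt_pow_iff_right₀ (one_lt_two (α := ℝ))).1 (hj.1.trans_lt hi.2)
  omega

theorem iUnion_bracketShell : ⋃ j, bracketShell j = Set.univ := by
  refine Set.eq_univ_of_forall fun x => ?_
  obtain ⟨n, h1, h2⟩ := exists_nat_pow_near (one_le_japaneseBracket x) one_lt_two
  exact Set.mem_iUnion.2 ⟨n, h1, h2⟩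

theorem bracketShell_subset_closedBall (j : ℕ) :
    bracketShell j ⊆ Metric.closedBall 0 (2 ^ (j + 1)) := by
  intro x hx
  rw [mem_closedBall_zero_iff]
  refine le_trans ?_ hx.2.le
  exact Real.le_sqrt_of_sq_le (by linarith)

theorem enorm_cutLp_bracketShell_le (j : ℕ) {b : ℝ} (hb : 0 ≤ b)
    (g : Lp ℂ 2 (volume : Measure E3)) :
    ‖cutLp (measurableSet_bracketShell j) g‖ₑ ≤ ENNReal.ofReal (2 ^ (-(b * j))) *
      eLpNorm (fun x => ((japaneseBracket x ^ b : ℝ) : ℂ) * g x) 2 volume := by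
  rw [enorm_cutLp]
  refine eLpNorm_le_mul_eLpNorm_of_ae_le_mul (Filter.Eventually.of_forall fun x => ?_) 2
  by_cases hx : x ∈ bracketShell j
  · rw [Set.indicator_of_mem hx, norm_mul, ← mul_assoc]
    refine le_mul_of_one_le_left (norm_nonneg _) ?_
    rw [Complex.norm_real, Real.norm_of_nonneg (by unfold japaneseBracket; positivity),
      Real.rpow_neg two_pos.le, mul_comm b, Real.rpow_mul two_pos.le, Real.rpow_natCast,
      inv_mul_eq_div, one_le_div (by positivity)]
    exact Real.rpow_le_rpow (by positivity) hx.1 hb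
  · rw [Set.indicator_of_notMem hx, norm_zero]
    positivity

theorem lintegral_const_mul_rpow_rpow {S : ℝ → ℝ≥0∞} (hS : Measurable S) (μ : Measure ℝ)
    (c : ℝ≥0∞) {p : ℝ} (hp : 0 < p) :
    (∫⁻ s, (c * S s ^ (2 / p)) ^ p ∂μ) ^ (1 / p) = c * (∫⁻ s, S s ^ 2 ∂μ) ^ (1 / p) := by
  have h : ∀ s, (c * S s ^ (2 / p)) ^ p = c ^ p * S s ^ 2 := fun s => by
    rw [ENNReal.mul_rpow_of_nonneg _ _ hp.le, ← ENNReal.rpow_mul, div_mul_cancel₀ _ hp.ne',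
      ENNReal.rpow_ofNat]
  simp only [h]
  rw [lintegral_const_mul _ (hS.pow_const 2), ENNReal.mul_rpow_of_nonneg _ _ (by positivity),
    ← ENNReal.rpow_mul, mul_one_div_cancel hp.ne', ENNReal.rpow_one]

/-- Every factor is a power of `2`, so after the constants are separated this is one linear
inequality between exponents. The last three factors are geometric in `m`, `j` and `n`. -/
theorem dyadic_term_bound {C M β₁ β₂ θ κ p E : ℝ} {ι : ℕ} (hC : 0 < C) (hM : 0 < M)
    (hE : -ι + (2 + 2 * θ + 2 * κ) / p ≤ E) {k : ℤ} (hk : -1 ≤ k) (m j n : ℕ) {l : ℝ}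
    (hl : l = 2 ^ (k + 1) / 2 ^ n) :
    ((2 : ℝ) ^ (m + 1)) ^ (1 / p * β₁) * (l⁻¹) ^ ι * M *
        (C * l ^ 2 * ((l * 2 ^ (j + 1)) ^ (2 * θ) * (l * 2 ^ m) ^ (2 * κ))) ^ (1 / p) *
        2 ^ (-(2 / p * β₂ * j)) ≤
      M * C ^ (1 / p) * 2 ^ ((β₁ + 2 * θ) / p + E) * 2 ^ (E * k) *
        ((2 ^ ((β₁ + 2 * κ) / p)) ^ m * (2 ^ (2 * (θ - β₂) / p)) ^ j *
          (2 ^ (ι - (2 + 2 * θ + 2 * κ) / p)) ^ n) := by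
  have h2 : (0 : ℝ) < 2 := two_pos
  have hl' : l = (2 : ℝ) ^ ((k : ℝ) + 1 - n) := by
    rw [hl, Real.rpow_sub h2, Real.rpow_natCast]
    congr 1
    exact_mod_cast (Real.rpow_intCast 2 (k + 1)).symm
  have e1 : ((2 : ℝ) ^ (m + 1)) ^ (1 / p * β₁) = 2 ^ (((m : ℝ) + 1) * (1 / p * β₁)) := by
    rw [Real.rpow_mul h2.le]
    congr 1
    exact_mod_cast (Real.rpow_natCast 2 (m + 1)).symm
  have e2 : (l⁻¹) ^ ι = (2 : ℝ) ^ (-((k : ℝ) + 1 - n) * ι) := by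
    rw [hl', ← Real.rpow_neg h2.le, Real.rpow_mul_natCast h2.le]
  have e3 : (l * 2 ^ (j + 1)) ^ (2 * θ) = (2 : ℝ) ^ (((k : ℝ) + 1 - n + (j + 1)) * (2 * θ)) := by
    rw [Real.rpow_mul h2.le, Real.rpow_add h2, ← hl']
    congr 2
    exact_mod_cast (Real.rpow_natCast 2 (j + 1)).symm
  have e4 : (l * 2 ^ m) ^ (2 * κ) = (2 : ℝ) ^ (((k : ℝ) + 1 - n + m) * (2 * κ)) := by
    rw [Real.rpow_mul h2.le, Real.rpow_add h2, ← hl', Real.rpow_natCast]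
  have e5 : l ^ 2 = (2 : ℝ) ^ (((k : ℝ) + 1 - n) * 2) := by
    rw [hl', ← Real.rpow_mul_natCast h2.le]
    norm_num
  have e6 : (C * l ^ 2 * ((l * 2 ^ (j + 1)) ^ (2 * θ) * (l * 2 ^ m) ^ (2 * κ))) ^ (1 / p) =
      C ^ (1 / p) * 2 ^ ((((k : ℝ) + 1 - n) * 2 + (((k : ℝ) + 1 - n + (j + 1)) * (2 * θ) +
        ((k : ℝ) + 1 - n + m) * (2 * κ))) * (1 / p)) := by
    rw [e3, e4, e5, mul_assoc, ← Real.rpow_add h2, ← Real.rpow_add h2,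
      Real.mul_rpow hC.le (by positivity), ← Real.rpow_mul h2.le]
  have f1 : ((2 : ℝ) ^ ((β₁ + 2 * κ) / p)) ^ m = 2 ^ ((β₁ + 2 * κ) / p * m) :=
    (Real.rpow_mul_natCast h2.le _ _).symm
  have f2 : ((2 : ℝ) ^ (2 * (θ - β₂) / p)) ^ j = 2 ^ (2 * (θ - β₂) / p * j) :=
    (Real.rpow_mul_natCast h2.le _ _).symm
  have f3 : ((2 : ℝ) ^ (ι - (2 + 2 * θ + 2 * κ) / p)) ^ n =
      2 ^ ((ι - (2 + 2 * θ + 2 * κ) / p) * n) :=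
    (Real.rpow_mul_natCast h2.le _ _).symm
  rw [e6, e1, e2, f1, f2, f3]
  have hk' : (0 : ℝ) ≤ (k : ℝ) + 1 := by exact_mod_cast (by linarith : (0 : ℤ) ≤ k + 1)
  -- Replacing the exact frequency exponent by the larger `E` is allowed because `k + 1 ≥ 0`.
  have hEk := mul_le_mul_of_nonneg_left hE hk'
  calc _ = M * C ^ (1 / p) * (2 ^ (((m : ℝ) + 1) * (1 / p * β₁)) *
          2 ^ (-((k : ℝ) + 1 - n) * ι) * 2 ^ ((((k : ℝ) + 1 - n) * 2 +
          (((k : ℝ) + 1 - n + (j + 1)) * (2 * θ) +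
          ((k : ℝ) + 1 - n + m) * (2 * κ))) * (1 / p)) * 2 ^ (-(2 / p * β₂ * j))) := by ring
    _ ≤ M * C ^ (1 / p) * (2 ^ ((β₁ + 2 * θ) / p + E) * 2 ^ (E * k) *
        (2 ^ ((β₁ + 2 * κ) / p * m) * 2 ^ (2 * (θ - β₂) / p * j) *
          2 ^ ((ι - (2 + 2 * θ + 2 * κ) / p) * n))) := by
        refine mul_le_mul_of_nonneg_left ?_ (by positivity)
        simp only [← Real.rpow_add h2]
        refine Real.rpow_le_rpow_of_exponent_le one_le_two ?_
        simp only [div_eq_mul_inv, one_mul] at hEk ⊢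
        linarith
    _ = _ := by ring

/-- The `L^r_x` norm of the weighted evolution, bounded by its pieces localised dyadically in
space-time, in the position of the data and in frequency. -/
theorem IsCutoff.eLpNorm_weighted_wave_le {ψ : ℝ → ℝ} (hψ : IsCutoff ψ) {ι : ℕ} (hι : ι ≤ 1)
    {k : ℤ} (f : 𝓢'(E3, ℂ)) (g : Lp ℂ 2 (volume : Measure E3))
    (hg : Lp.toTemperedDistribution g = lpProj ψ k f) (σ : ℝ) {s : ℝ} (hs : 0 ≤ s)
    {l : ℕ → ℝ} (hl : ∀ n, 0 < l n) (hl2 : ∀ n, l n = 2 ^ (k + 1) / 2 ^ n)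
    {M : ℝ} (hM : ∀ ρ, |waveAmplitude ψ ι ρ| ≤ M) {p w : ℝ} {r : ℝ≥0∞} (hp : 2 ≤ p) (hw : 0 ≤ w)
    (hpr : (ENNReal.ofReal p)⁻¹ + r⁻¹ = 2⁻¹) :
    eLpNorm (fun x => (((1 + s + ‖x‖) ^ w : ℝ) : ℂ) * wave ι σ s g x) r volume ≤
      ∑' i : ℕ × ℕ × ℕ,
        (ENNReal.ofReal (((2 : ℝ) ^ (i.1 + 1)) ^ w * ((l i.2.2)⁻¹) ^ ι) *
          (ENNReal.ofReal M * ‖cutLp (measurableSet_bracketShell i.2.1) g‖ₑ) ^ (1 - 2 / p)) *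
        shellSup (2 ^ i.1) (fun s x => halfWave ((hψ.isAmplitude ι).dilate (hl i.2.2)) (σ * s) x
          (cutLp (measurableSet_bracketShell i.2.1) g)) s ^ (2 / p) := by
  set U : ℕ × ℕ × ℕ → E3 → ℂ := fun i x => halfWave ((hψ.isAmplitude ι).dilate (hl i.2.2)) (σ * s) x
    (cutLp (measurableSet_bracketShell i.2.1) g) with hU
  set A : ℕ → Set E3 := fun m => {x | (2 : ℝ) ^ m / 2 < 1 + s + ‖x‖ ∧ 1 + s + ‖x‖ < 2 * 2 ^ m}
    with hA
  have hAm : ∀ m, MeasurableSet (A m) := fun m =>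
    MeasurableSet.inter (s₁ := {x : E3 | (2 : ℝ) ^ m / 2 < 1 + s + ‖x‖})
      (s₂ := {x : E3 | 1 + s + ‖x‖ < 2 * 2 ^ m})
      (measurableSet_lt (by fun_prop) (by fun_prop)) (measurableSet_lt (by fun_prop) (by fun_prop))
  set c : ℕ × ℕ × ℕ → ℝ := fun i => ((2 : ℝ) ^ (i.1 + 1)) ^ w * ((l i.2.2)⁻¹) ^ ι with hc
  have hc0 : ∀ i, 0 ≤ c i := fun i => by have := hl i.2.2; simp only [hc]; positivity
  have hUm : ∀ i, AEStronglyMeasurable (U i) volume := fun i =>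
    (continuous_halfWave_space _ _ _).aestronglyMeasurable
  have hpt : ∀ x, ‖(((1 + s + ‖x‖) ^ w : ℝ) : ℂ) * wave ι σ s g x‖ₑ ≤
      ∑' i : ℕ × ℕ × ℕ, ‖((c i : ℂ) • (A i.1).indicator (U i)) x‖ₑ := by
    intro x
    -- Only the shell containing `x` is needed, and there the weight is at most `2^((m+1)w)`. The
    -- other values of `m` merely enlarge the sum.
    obtain ⟨m, hm1, hm2⟩ := exists_nat_pow_near (x := 1 + s + ‖x‖) (y := 2)
      (by linarith [norm_nonneg x]) one_lt_two
    have hxA : x ∈ A m := ⟨by linarith [pow_pos (two_pos (α := ℝ)) m], by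
      rw [pow_succ] at hm2; linarith⟩
    have h1 : ‖wave ι σ s g x‖ₑ ≤ ∑' n, ∑' j, ENNReal.ofReal (((l n)⁻¹) ^ ι) * ‖U (m, j, n) x‖ₑ := by
      refine (enorm_le_tsum_of_hasSum
        (hψ.tendsto_sum_halfWave hι f g hg σ s x hl hl2)).trans (ENNReal.tsum_le_tsum fun n => ?_)
      have hln := hl n
      rw [enorm_mul, ENNReal.tsum_mul_left, ← ofReal_norm (((((l n)⁻¹) ^ ι : ℝ) : ℂ)),
        Complex.norm_real, Real.norm_of_nonneg (by positivity)]
      gcongr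
      exact enorm_le_tsum_of_hasSum (hasSum_halfWave_cutLp ((hψ.isAmplitude ι).dilate (hl n))
        measurableSet_bracketShell pairwise_disjoint_bracketShell iUnion_bracketShell
        (σ * s) x g).tendsto_sum_nat
    have h2 : ‖(((1 + s + ‖x‖) ^ w : ℝ) : ℂ)‖ₑ ≤ ENNReal.ofReal (((2 : ℝ) ^ (m + 1)) ^ w) := by
      have hpos : 0 ≤ 1 + s + ‖x‖ := by positivity
      rw [← ofReal_norm, Complex.norm_real, Real.norm_of_nonneg (by positivity)]
      exact ENNReal.ofReal_le_ofReal (Real.rpow_le_rpow hpos hm2.le hw)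
    calc _ = ‖(((1 + s + ‖x‖) ^ w : ℝ) : ℂ)‖ₑ * ‖wave ι σ s g x‖ₑ := enorm_mul _ _
      _ ≤ ENNReal.ofReal (((2 : ℝ) ^ (m + 1)) ^ w) *
          ∑' n, ∑' j, ENNReal.ofReal (((l n)⁻¹) ^ ι) * ‖U (m, j, n) x‖ₑ := mul_le_mul' h2 h1
      _ = ∑' n, ∑' j, ‖((c (m, j, n) : ℂ) • (A m).indicator (U (m, j, n))) x‖ₑ := by
          rw [← ENNReal.tsum_mul_left]
          refine tsum_congr fun n => ?_
          rw [← ENNReal.tsum_mul_left]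
          refine tsum_congr fun j => ?_
          rw [Pi.smul_apply, Set.indicator_of_mem hxA, smul_eq_mul, enorm_mul, ← mul_assoc,
            ← ENNReal.ofReal_mul (by positivity), ← ofReal_norm ((c (m, j, n) : ℝ) : ℂ),
            Complex.norm_real, Real.norm_of_nonneg (hc0 _)]
      _ = ∑' q : ℕ × ℕ, ‖((c (m, q) : ℂ) • (A m).indicator (U (m, q))) x‖ₑ := by
          rw [ENNReal.tsum_comm, ENNReal.tsum_prod']
      _ ≤ ∑' m, ∑' q : ℕ × ℕ, ‖((c (m, q) : ℂ) • (A m).indicator (U (m, q))) x‖ₑ :=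
          ENNReal.le_tsum m
      _ = _ := (ENNReal.tsum_prod (f := fun m q =>
          ‖((c (m, q) : ℂ) • (A m).indicator (U (m, q))) x‖ₑ)).symm
  have hr1 : 1 ≤ r := by
    have : r⁻¹ ≤ 1 := by
      calc r⁻¹ ≤ (ENNReal.ofReal p)⁻¹ + r⁻¹ := le_add_self
        _ = 2⁻¹ := hpr
        _ ≤ 1 := by norm_num
    exact ENNReal.inv_le_one.1 this
  refine (eLpNorm_le_tsum volume (fun i => ((hUm i).indicator (hAm i.1)).const_smul (c i : ℂ))
    hpt hr1).trans (ENNReal.tsum_le_tsum fun i => ?_)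
  rw [eLpNorm_const_smul, ← ofReal_norm ((c i : ℝ) : ℂ), Complex.norm_real,
    Real.norm_of_nonneg (hc0 i), mul_assoc]
  gcongr
  rw [mul_comm]
  refine eLpNorm_le_rpow_mul_rpow ((hUm i).indicator (hAm i.1)) (fun x => ?_) ?_ hp hpr
  · rw [enorm_indicator_eq_indicator_enorm]
    refine Set.indicator_apply_le' (fun hx => ?_) fun _ => zero_le
    exact le_iSup₂_of_le (f := fun (x : E3) (_ : s ∈ {s : ℝ | (2 : ℝ) ^ i.1 / 2 < 1 + s + ‖x‖ ∧
      1 + s + ‖x‖ < 2 * 2 ^ i.1}) => ‖U i x‖ₑ) x hx le_rfl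
  · exact (eLpNorm_indicator_le _).trans
      (eLpNorm_halfWave_le _ (fun ρ => hM (ρ / l i.2.2)) (σ * s) _)

/-- The weighted Strichartz estimate for `|∇|^{-ι} e^{±is|∇|}`, with `ι ∈ {0, 1}`. -/
theorem IsCutoff.weighted_strichartz {ψ : ℝ → ℝ} (hψ : IsCutoff ψ) {β₁ β₂ : ℝ} (hβ₁ : 0 < β₁)
    (hβ : β₁ < β₂) (hβ₂ : β₂ < 1) {ι : ℕ} (hι : ι ≤ 1) {p : ℝ} {r : ℝ≥0∞} (hp : 2 ≤ p)
    (hιp : ι * p < 2 + 2 * β₂ - β₁) (hpr : (ENNReal.ofReal p)⁻¹ + r⁻¹ = 2⁻¹) :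
    ∃ C : ℝ, 0 < C ∧ ∀ (σ : ℝ), |σ| = 1 → ∀ (k : ℤ), -1 ≤ k →
      ∀ (f : 𝓢'(E3, ℂ)) (g : Lp ℂ 2 (volume : Measure E3)),
      Lp.toTemperedDistribution g = lpProj ψ k f → ∀ t₀ t : ℝ, 0 ≤ t₀ →
        mixedNorm p r t₀ t
            (fun s x => (((1 + s + ‖x‖) ^ (1 / p * β₁) : ℝ) : ℂ) * wave ι σ s g x)
          ≤ ENNReal.ofReal (C * (2 : ℝ) ^ (((2 + 2 * β₂) / p - ι) * k)) *
            eLpNorm (fun x => ((japaneseBracket x ^ (2 / p * β₂) : ℝ) : ℂ) * g x) 2 volume := by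
  have hp0 : 0 < p := by linarith
  have hβ₂0 : 0 < β₂ := by linarith
  -- The slack `δ` keeps `κ > -θ/2` and `ι p < 2 + 2θ + 2κ` true after `θ` and `κ` have been moved
  -- off their limiting values `β₂` and `-β₁/2`.
  set δ : ℝ := min ((2 + 2 * β₂ - β₁ - ι * p) / 8) ((β₂ - β₁) / 4) with hδ
  have hδ0 : 0 < δ := lt_min (by linarith) (by linarith)
  have hδ1 : δ ≤ (2 + 2 * β₂ - β₁ - ι * p) / 8 := min_le_left _ _
  have hδ2 : δ ≤ (β₂ - β₁) / 4 := min_le_right _ _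
  set θ : ℝ := β₂ - δ with hθ
  set κ : ℝ := -β₁ / 2 - δ / 4 with hκ
  obtain ⟨M, hM0, hM⟩ := (hψ.isAmplitude ι).exists_bound
  obtain ⟨C, hC0, hC⟩ := exists_shell_strichartz (hψ.isAmplitude ι) (θ := θ) (κ := κ)
    (by linarith) (by linarith) (by linarith) (by linarith)
  set E : ℝ := (2 + 2 * β₂) / p - ι with hE
  have hEle : -ι + (2 + 2 * θ + 2 * κ) / p ≤ E := by
    rw [hE, neg_add_eq_sub]
    exact sub_le_sub_right (div_le_div_of_nonneg_right (by linarith) hp0.le) _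
  -- The ratios of the sums over space-time shells, data shells and frequencies; all three are below
  -- `1` by the choice of `δ`.
  set q₁ : ℝ := 2 ^ ((β₁ + 2 * κ) / p) with hq₁
  set q₂ : ℝ := 2 ^ (2 * (θ - β₂) / p) with hq₂
  set q₃ : ℝ := 2 ^ (ι - (2 + 2 * θ + 2 * κ) / p) with hq₃
  have hq₁1 : q₁ < 1 := Real.rpow_lt_one_of_one_lt_of_neg one_lt_two
    (div_neg_of_neg_of_pos (by linarith) hp0)
  have hq₂1 : q₂ < 1 := Real.rpow_lt_one_of_one_lt_of_neg one_lt_two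
    (div_neg_of_neg_of_pos (by linarith) hp0)
  have hq₃1 : q₃ < 1 := by
    refine Real.rpow_lt_one_of_one_lt_of_neg one_lt_two (sub_neg.2 ?_)
    rw [lt_div_iff₀ hp0]
    linarith
  set M' : ℝ := M ^ (1 - 2 / p) with hM'
  have hM'0 : 0 < M' := by positivity
  set K : ℝ := M' * C ^ (1 / p) * 2 ^ ((β₁ + 2 * θ) / p + E) with hK
  have hK0 : 0 < K := by positivity
  set Z : ℝ≥0∞ := ∑' i : ℕ × ℕ × ℕ, ENNReal.ofReal (q₁ ^ i.1 * q₂ ^ i.2.1 * q₃ ^ i.2.2) with hZ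
  have hZtop : Z ≠ ⊤ := by
    have e : Z = (1 - ENNReal.ofReal q₁)⁻¹ * ((1 - ENNReal.ofReal q₂)⁻¹ *
        (1 - ENNReal.ofReal q₃)⁻¹) := by
      rw [hZ, ENNReal.tsum_prod' , ← ENNReal.tsum_geometric, ← ENNReal.tsum_geometric,
        ← ENNReal.tsum_geometric, ← ENNReal.tsum_mul_right]
      refine tsum_congr fun m => ?_
      rw [ENNReal.tsum_prod', ← ENNReal.tsum_mul_right, ← ENNReal.tsum_mul_left]
      refine tsum_congr fun j => ?_
      rw [← ENNReal.tsum_mul_left, ← ENNReal.tsum_mul_left]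
      refine tsum_congr fun n => ?_
      rw [ENNReal.ofReal_mul (by positivity), ENNReal.ofReal_mul (by positivity),
        ENNReal.ofReal_pow (by positivity), ENNReal.ofReal_pow (by positivity),
        ENNReal.ofReal_pow (by positivity), mul_assoc]
    have hfin : ∀ q : ℝ, q < 1 → (1 - ENNReal.ofReal q)⁻¹ ≠ ⊤ := fun q hq => by
      rw [ENNReal.inv_ne_top]
      exact (tsub_pos_of_lt (ENNReal.ofReal_lt_one.2 hq)).ne'
    rw [e]
    exact ENNReal.mul_ne_top (hfin _ hq₁1) (ENNReal.mul_ne_top (hfin _ hq₂1) (hfin _ hq₃1))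
  refine ⟨K * (Z.toReal + 1), by positivity, fun σ hσ k hk f g hg t₀ t ht₀ => ?_⟩
  set B : ℝ≥0∞ := eLpNorm (fun x => ((japaneseBracket x ^ (2 / p * β₂) : ℝ) : ℂ) * g x) 2 volume
    with hB
  set l : ℕ → ℝ := fun n => 2 ^ (k + 1) / 2 ^ n with hldef
  have hl : ∀ n, 0 < l n := fun n => by simp only [hldef]; positivity
  set G : ℕ → Lp ℂ 2 (volume : Measure E3) := fun j => cutLp (measurableSet_bracketShell j) g
    with hG
  set S : ℕ × ℕ × ℕ → ℝ → ℝ≥0∞ := fun i => shellSup (2 ^ i.1) (fun s x =>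
    halfWave ((hψ.isAmplitude ι).dilate (hl i.2.2)) (σ * s) x (G i.2.1)) with hS
  have hSm : ∀ i, Measurable (S i) := fun i => measurable_shellSup _ fun x =>
    (continuous_halfWave_time _ x _).comp (continuous_const.mul continuous_id)
  set c : ℕ × ℕ × ℕ → ℝ≥0∞ := fun i =>
    ENNReal.ofReal (((2 : ℝ) ^ (i.1 + 1)) ^ (1 / p * β₁) * ((l i.2.2)⁻¹) ^ ι) *
      (ENNReal.ofReal M * ‖G i.2.1‖ₑ) ^ (1 - 2 / p) with hc
  have h2p : 0 ≤ 1 - 2 / p := sub_nonneg.2 ((div_le_one hp0).2 hp)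
  have hterm : ∀ i, c i * (∫⁻ s in Set.Ici 0, S i s ^ 2) ^ (1 / p) ≤
      ENNReal.ofReal (K * 2 ^ (E * k)) *
        ENNReal.ofReal (q₁ ^ i.1 * q₂ ^ i.2.1 * q₃ ^ i.2.2) * B := by
    rintro ⟨m, j, n⟩
    have hln := hl n
    have hsh := hC (l n) (hl n) (2 ^ (j + 1)) (2 ^ m) σ (one_le_pow₀ one_le_two) (by positivity) hσ
      (bracketShell j) (measurableSet_bracketShell j) (bracketShell_subset_closedBall j) g
    set Q : ℝ := C * l n ^ 2 * ((l n * 2 ^ (j + 1)) ^ (2 * θ) * (l n * 2 ^ m) ^ (2 * κ)) with hQ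
    have hQ0 : 0 ≤ Q := by positivity
    set c₀ : ℝ := ((2 : ℝ) ^ (m + 1)) ^ (1 / p * β₁) * ((l n)⁻¹) ^ ι with hc₀
    have hc₀0 : 0 ≤ c₀ := by positivity
    have hcut := enorm_cutLp_bracketShell_le j (b := 2 / p * β₂) (by positivity) g
    calc c (m, j, n) * (∫⁻ s in Set.Ici 0, S (m, j, n) s ^ 2) ^ (1 / p)
        ≤ ENNReal.ofReal c₀ * (ENNReal.ofReal M * ‖G j‖ₑ) ^ (1 - 2 / p) *
            (ENNReal.ofReal Q * ‖G j‖ₑ ^ 2) ^ (1 / p) := by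
          gcongr
      _ = ENNReal.ofReal (c₀ * M' * Q ^ (1 / p)) * ‖G j‖ₑ := by
          rw [ENNReal.mul_rpow_of_nonneg _ _ h2p, ENNReal.mul_rpow_of_nonneg _ _ (by positivity),
            ENNReal.ofReal_rpow_of_pos hM0, ENNReal.ofReal_rpow_of_nonneg hQ0 (by positivity),
            ENNReal.ofReal_mul (show 0 ≤ c₀ * M' by positivity), ENNReal.ofReal_mul hc₀0, ← ENNReal.rpow_ofNat,
            ← ENNReal.rpow_mul, mul_one_div]
          -- The `L²_x` bound and the shell bound carry complementary powers of the norm of the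
          -- data, so the result is linear in it.
          have : ‖G j‖ₑ ^ (1 - 2 / p) * ‖G j‖ₑ ^ (2 / p) = ‖G j‖ₑ := by
            rw [← ENNReal.rpow_add_of_nonneg _ _ h2p (by positivity), sub_add_cancel,
              ENNReal.rpow_one]
          calc _ = ENNReal.ofReal c₀ * ENNReal.ofReal (M ^ (1 - 2 / p)) *
                ENNReal.ofReal (Q ^ (1 / p)) *
                (‖G j‖ₑ ^ (1 - 2 / p) * ‖G j‖ₑ ^ (2 / p)) := by ring
            _ = _ := by rw [this]
      _ ≤ ENNReal.ofReal (c₀ * M' * Q ^ (1 / p)) *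
          (ENNReal.ofReal (2 ^ (-(2 / p * β₂ * j))) * B) := by gcongr
      _ = ENNReal.ofReal (c₀ * M' * Q ^ (1 / p) * 2 ^ (-(2 / p * β₂ * j))) * B := by
          rw [← mul_assoc, ← ENNReal.ofReal_mul (by positivity)]
      _ ≤ ENNReal.ofReal (K * 2 ^ (E * k) * (q₁ ^ m * q₂ ^ j * q₃ ^ n)) * B := by
          refine mul_le_mul' (ENNReal.ofReal_le_ofReal ?_) le_rfl
          exact dyadic_term_bound hC0 hM'0 hEle hk m j n rfl
      _ = _ := by rw [ENNReal.ofReal_mul (by positivity)]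
  calc mixedNorm p r t₀ t
          (fun s x => (((1 + s + ‖x‖) ^ (1 / p * β₁) : ℝ) : ℂ) * wave ι σ s g x)
      ≤ (∫⁻ s in Set.Icc t₀ t, (∑' i, c i * S i s ^ (2 / p)) ^ p) ^ (1 / p) := by
        rw [mixedNorm]
        refine ENNReal.rpow_le_rpow (setLIntegral_mono' measurableSet_Icc fun s hs =>
          ENNReal.rpow_le_rpow ?_ hp0.le) (by positivity)
        exact hψ.eLpNorm_weighted_wave_le hι f g hg σ (ht₀.trans hs.1) hl (fun n => rfl) hM hp
          (by positivity) hpr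
    _ ≤ (∫⁻ s in Set.Ici 0, (∑' i, c i * S i s ^ (2 / p)) ^ p) ^ (1 / p) :=
        ENNReal.rpow_le_rpow (lintegral_mono_set fun s hs => ht₀.trans hs.1) (by positivity)
    _ ≤ ∑' i, (∫⁻ s in Set.Ici 0, (c i * S i s ^ (2 / p)) ^ p) ^ (1 / p) :=
        lintegral_Lp_tsum_le _ (fun i => (((hSm i).pow_const _).const_mul _).aemeasurable)
          (by linarith)
    _ = ∑' i, c i * (∫⁻ s in Set.Ici 0, S i s ^ 2) ^ (1 / p) :=
        tsum_congr fun i => lintegral_const_mul_rpow_rpow (hSm i) _ _ hp0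
    _ ≤ ∑' i : ℕ × ℕ × ℕ, ENNReal.ofReal (K * 2 ^ (E * k)) *
        ENNReal.ofReal (q₁ ^ i.1 * q₂ ^ i.2.1 * q₃ ^ i.2.2) * B := ENNReal.tsum_le_tsum hterm
    _ = ENNReal.ofReal (K * 2 ^ (E * k)) * Z * B := by
        rw [ENNReal.tsum_mul_right, ENNReal.tsum_mul_left]
    _ ≤ ENNReal.ofReal (K * 2 ^ (E * k)) * ENNReal.ofReal (Z.toReal + 1) * B := by
        gcongr
        exact (ENNReal.ofReal_toReal hZtop).symm.le.trans
          (ENNReal.ofReal_le_ofReal (by linarith))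
    _ = _ := by
        rw [← ENNReal.ofReal_mul (by positivity)]
        congr 2
        ring

end

/-! ### The two estimates -/

theorem theorem3p1 (ψ : ℝ → ℝ) (hψ : IsCutoff ψ) (β₁ β₂ : ℝ)
    (hβ₁ : β₁ ∈ Set.Ioo (0 : ℝ) 1) (hβ₂ : β₂ ∈ Set.Ioo β₁ (min (3 / 2 * β₁) 1)) :
    (∀ (p : ℝ) (r : ℝ≥0∞), 2 ≤ p → (ENNReal.ofReal p)⁻¹ + r⁻¹ = 2⁻¹ →
      ∃ C : ℝ, 0 < C ∧ ∀ (σ : ℝ), (σ = 1 ∨ σ = -1) → ∀ (k : ℤ), -1 ≤ k →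
        ∀ (f : 𝓢'(E3, ℂ)) (Pf : Lp ℂ 2 (volume : Measure E3)),
        Lp.toTemperedDistribution Pf = lpProj ψ k f →
        (∀ s : ℝ, Integrable (waveFreq 0 σ s Pf)) ∧
        ∀ t₀ t : ℝ, 0 ≤ t₀ → t₀ ≤ t →
          mixedNorm p r t₀ t
              (fun s x => (((1 + s + ‖x‖) ^ (1 / p * β₁) : ℝ) : ℂ) * wave 0 σ s Pf x)
            ≤ ENNReal.ofReal (C * (2 : ℝ) ^ (2 / p * (1 + β₂) * k)) *
              eLpNorm (fun x => ((japaneseBracket x ^ (2 / p * β₂) : ℝ) : ℂ) * Pf x) 2 volume) ∧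
    (∀ (p : ℝ) (r : ℝ≥0∞), 2 ≤ p → p < 2 + 2 * β₂ - β₁ →
      (ENNReal.ofReal p)⁻¹ + r⁻¹ = 2⁻¹ →
      ∃ C : ℝ, 0 < C ∧ ∀ (σ : ℝ), (σ = 1 ∨ σ = -1) → ∀ (k : ℤ), -1 ≤ k →
        ∀ (f : 𝓢'(E3, ℂ)) (Pf : Lp ℂ 2 (volume : Measure E3)),
        Lp.toTemperedDistribution Pf = lpProj ψ k f →
        (∀ s : ℝ, Integrable (waveFreq 1 σ s Pf)) ∧
        ∀ t₀ t : ℝ, 0 ≤ t₀ → t₀ ≤ t →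
          mixedNorm p r t₀ t
              (fun s x => (((1 + s + ‖x‖) ^ (1 / p * β₁) : ℝ) : ℂ) * wave 1 σ s Pf x)
            ≤ ENNReal.ofReal (C * (2 : ℝ) ^ (((2 + 2 * β₂) / p - 1) * k)) *
              eLpNorm (fun x => ((japaneseBracket x ^ (2 / p * β₂) : ℝ) : ℂ) * Pf x) 2 volume) := by
  have hβ1 : β₂ < 1 := hβ₂.2.trans_le (min_le_right _ _)
  have hσ : ∀ σ : ℝ, (σ = 1 ∨ σ = -1) → |σ| = 1 := by
    rintro σ (rfl | rfl) <;> simp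
  refine ⟨fun p r hp hpr => ?_, fun p r hp hp2 hpr => ?_⟩
  · obtain ⟨C, hC0, hC⟩ := hψ.weighted_strichartz hβ₁.1 hβ₂.1 hβ1 (ι := 0) (by norm_num) hp
      -- For `ι = 0` the low-frequency condition is `0 < 2 + 2β₂ - β₁`, so `p` is unrestricted
      -- above.
      (by push_cast; linarith [hβ₁.1, hβ₂.1]) hpr
    refine ⟨C, hC0, fun σ hs k hk f g hg =>
      ⟨fun s => hψ.integrable_waveFreq (by norm_num) f g hg σ s, fun t₀ t h0 _ => ?_⟩⟩
    have h := hC σ (hσ σ hs) k hk f g hg t₀ t h0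
    rwa [show (2 + 2 * β₂) / p - ((0 : ℕ) : ℝ) = 2 / p * (1 + β₂) by push_cast; ring] at h
  · obtain ⟨C, hC0, hC⟩ := hψ.weighted_strichartz hβ₁.1 hβ₂.1 hβ1 (ι := 1) le_rfl hp
      (by push_cast; linarith) hpr
    refine ⟨C, hC0, fun σ hs k hk f g hg =>
      ⟨fun s => hψ.integrable_waveFreq le_rfl f g hg σ s, fun t₀ t h0 _ => ?_⟩⟩
    have h := hC σ (hσ σ hs) k hk f g hg t₀ t h0
    rwa [Nat.cast_one] at h
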